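/- **Definitions.** A function $F$ belongs to the Selberg class $\mathcal S$ if: (1) $F(s)=\sum_{n\ge1}a(n)n^{-s}$ converges absolutely for $\sigma=\Re s>1$; (2) $(s-1)^mF(s)$ is entire of finite order for some integer $m\ge0$; (3) $\Phi(s)=\omega\,\overline{\Phi(1-\bar s)}$, where $\Phi(s)=Q^s\prod_{j=1}^r\Gamma(\lambda_js+\mu_j)\,F(s)$ with $|\omega|=1$, $r\ge 0$, $Q>0$, $\lambda_j>0$, $\Re\mu_j\ge0$; (4) $a(n)\ll n^{\varepsilon}$ for every $\varepsilon>0$; (5) $\log F(s)=\sum_n b(n)n^{-s}$ for $\sigma>1$, with $b(n)=0$ unless $n=\ell^m$ for a prime $\ell$ and some $m\ge1$, and $b(n)\ll n^{\vartheta}$ for some $\vartheta<1/2$. The degree and conductor of $F$ are $d_F=2\sum_j\lambda_j$ and $q_F=(2\pi)^{d_F}Q^2\prod_j\lambda_j^{2\lambda_j}$, and $\mathcal S_d=\{F\in\mathcal S: d_F=d\}$. The local factor of $F$ at a prime $p$ is $F_p(s)=\sum_{m\ge0}a(p^m)p^{-ms}$ (for $\sigma>0$). Let $N_F(\sigma,T)=|\{\rho=\beta+i\gamma: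 F(\rho)=0,\ \beta>\sigma,\ |\gamma|\le T\}|$. For $\alpha\in\mathbb R$ and a Dirichlet character $\chi$ put, for $\sigma>1$, $$F(s,\alpha)=\sum_{n\ge1}\frac{a(n)e^{-2\pi i n\alpha}}{n^s},\qquad F(s,\chi)=\sum_{n\ge1}\frac{a(n)\chi(n)}{n^s}.$$ For real $d,h>0$ let $M(d,h)$ be the class of functions $f$ that are meromorphic on $\mathbb C$, holomorphic for $\sigma<1$, and such that for every $A<B$ there is a constant $C=C(A,B)$ with $$f(\sigma+it)\ll|\sigma|^{d|\sigma|}\Big(\frac{h}{(2\pi e)^d}\Big)^{|\sigma|}|\sigma|^{C}$$ as $\sigma\to-\infty$, uniformly for $A\le t\le B$, where the implied constant may depend on $d,h,A,B,f$. A Dirichlet series converging for $\sigma>1$ is said to belong to $M(d,h)$ if it has a meromorphic continuation to $\mathbb C$ which belongs to $M(d,h)$. **Theorem 1.** Let $d>0$ and let $F\in\mathcal S_d$ be such that $N_F(\sigma,T)=o(T)$ as $T\to\infty$ for every fixed $\sigma>1/2$. Let $p$ be a prime number and $h>0$. Then the following statements are equivalent: (i) for every integer $a\not\equiv0\pmod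 p$, the linear twist $F(s,a/p)$ belongs to $M(d,h)$; (ii) for every Dirichlet character $\chi\pmod p$ with $\chi\ne\chi_0$ (the principal character), the twist $F(s,\chi)$ belongs to $M(d,h)$; and there are an integer $\partial_p\ge0$ and complex numbers $\alpha_1(p),\dots,\alpha_{\partial_p}(p)$ such that $$F_p(s)=\prod_{j=1}^{\partial_p}\Big(1-\frac{\alpha_j(p)}{p^s}\Big)^{-1},\qquad|\alpha_j(p)|\le1,\qquad \partial_p\le\Big[\frac{\log(h/q_F)}{\log p}\Big],$$ where $[x]$ denotes the greatest integer not exceeding $x$. -/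

import Mathlib

open Filter Asymptotics

namespace SelbergTwist

noncomputable section

/-- The data `ω, Q, r, λ_j, μ_j` of a functional equation of Selberg type. -/
structure FunctionalEquationData where
  omega : ℂ
  Q : ℝ
  r : ℕ
  lam : Fin r → ℝ
  mu : Fin r → ℂ
  norm_omega : ‖omega‖ = 1
  Q_pos : 0 < Q
  lam_pos : ∀ j, 0 < lam j
  mu_re_nonneg : ∀ j, 0 ≤ (mu j).re

namespace FunctionalEquationData

/-- The degree `d_F = 2 ∑ λ_j`. -/
def degree (D : FunctionalEquationData) : ℝ := 2 * ∑ j, D.lam j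

/-- The conductor `q_F = (2π)^{d_F} Q² ∏ λ_j^{2 λ_j}`. -/
def conductor (D : FunctionalEquationData) : ℝ :=
  (2 * Real.pi) ^ D.degree * D.Q ^ 2 * ∏ j, D.lam j ^ (2 * D.lam j)

/-- The completed function `Φ(s) = Q^s ∏ Γ(λ_j s + μ_j) F(s)`. -/
def completed (D : FunctionalEquationData) (F : ℂ → ℂ) (s : ℂ) : ℂ :=
  (D.Q : ℂ) ^ s * (∏ j, Complex.Gamma (D.lam j * s + D.mu j)) * F s

/-- `s` is not a pole of any of the factors `Γ(λ_j s + μ_j)`. -/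
def GammaRegular (D : FunctionalEquationData) (s : ℂ) : Prop :=
  ∀ (j : Fin D.r) (n : ℕ), (D.lam j : ℂ) * s + D.mu j ≠ -(n : ℂ)

end FunctionalEquationData

/-- `G` has finite order of growth. -/
def HasFiniteOrder (G : ℂ → ℂ) : Prop :=
  ∃ A C : ℝ, ∀ s : ℂ, ‖G s‖ ≤ C * Real.exp (‖s‖ ^ A)

/-- `F`, with Dirichlet coefficients `a(n)`, `n ≥ 1`, belongs to the Selberg class, and satisfies
the functional equation with the data `D`.

The only possible pole of `F` is `s = 1`; the value of the Lean function `F` at that single point is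
left free, as nothing below depends on it. The value `a 0` is never used. -/
structure IsSelberg (a : ℕ → ℂ) (F : ℂ → ℂ) (D : FunctionalEquationData) : Prop where
  /-- absolutely convergent Dirichlet series for `σ > 1` -/
  dirichlet : ∀ s : ℂ, 1 < s.re → LSeriesSummable a s ∧ F s = LSeries a s
  /-- `(s - 1)^m F(s)` is entire of finite order for some `m ≥ 0` -/
  continuation : ∃ (m : ℕ) (G : ℂ → ℂ), Differentiable ℂ G ∧ HasFiniteOrder G ∧
    ∀ s : ℂ, s ≠ 1 → G s = (s - 1) ^ m * F s
  /-- `Φ(s) = ω * conj (Φ(1 - conj s))`, wherever both sides have no singular factor -/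
  functional_equation : ∀ s : ℂ, s ≠ 0 → s ≠ 1 →
    D.GammaRegular s → D.GammaRegular (1 - (starRingEnd ℂ) s) →
    D.completed F s = D.omega * (starRingEnd ℂ) (D.completed F (1 - (starRingEnd ℂ) s))
  /-- `a(n) ≪ n^ε` for every `ε > 0` -/
  ramanujan : ∀ ε : ℝ, 0 < ε → ∃ C : ℝ, ∀ n : ℕ, 1 ≤ n → ‖a n‖ ≤ C * (n : ℝ) ^ ε
  /-- `log F(s) = ∑ b(n) n^{-s}` with `b` supported on the prime powers `p^m`, `m ≥ 1`, and
  `b(n) ≪ n^θ` for some `θ < 1/2` -/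
  euler : ∃ (b : ℕ → ℂ) (θ C : ℝ), θ < 1 / 2 ∧ (∀ n : ℕ, ¬ IsPrimePow n → b n = 0) ∧
    (∀ n : ℕ, 1 ≤ n → ‖b n‖ ≤ C * (n : ℝ) ^ θ) ∧
    ∀ s : ℂ, 1 < s.re → LSeriesSummable b s ∧ F s = Complex.exp (LSeries b s)

/-- The `p`-th local factor `F_p(s) = ∑_{m ≥ 0} a(p^m) p^{-ms}` of the Euler product
(the series converges absolutely for `σ > 0`). -/
def localFactor (a : ℕ → ℂ) (p : ℕ) (s : ℂ) : ℂ :=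
  ∑' m : ℕ, a (p ^ m) * (p : ℂ) ^ (-((m : ℂ) * s))

/-- The zero-counting function `N_F(σ, T)`. -/
def zeroCount (F : ℂ → ℂ) (σ T : ℝ) : ℕ :=
  {ρ : ℂ | F ρ = 0 ∧ σ < ρ.re ∧ |ρ.im| ≤ T}.ncard

/-- The coefficients `a(n) e(-nα)` of the linear twist `F(s, α)`, where `e(x) = exp(2πix)`. -/
def linearTwist (a : ℕ → ℂ) (α : ℝ) (n : ℕ) : ℂ :=
  a n * Complex.exp (2 * Real.pi * Complex.I * (-((n : ℂ) * (α : ℂ))))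

/-- The coefficients `a(n) χ(n)` of the twist `F(s, χ)`. -/
def characterTwist (a : ℕ → ℂ) {q : ℕ} (χ : DirichletCharacter ℂ q) (n : ℕ) : ℂ :=
  a n * χ (n : ZMod q)

/-- The class `M(d, h)`. -/
structure MemM (d h : ℝ) (f : ℂ → ℂ) : Prop where
  meromorphic : ∀ s : ℂ, MeromorphicAt f s
  holomorphic : DifferentiableOn ℂ f {s : ℂ | s.re < 1}
  growth : ∀ A B : ℝ, A < B → ∃ C K : ℝ, ∀ᶠ σ : ℝ in atBot, ∀ t ∈ Set.Icc A B,
    ‖f (σ + t * Complex.I)‖ ≤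
      K * (|σ| ^ (d * |σ|) * (h / (2 * Real.pi * Real.exp 1) ^ d) ^ |σ| * |σ| ^ C)

/-- The Dirichlet series `∑ c(n) n^{-s}`, given for `σ > 1`, belongs to `M(d, h)`: it is the
restriction to `σ > 1` of a (necessarily unique) meromorphic function in `M(d, h)`. -/
def SeriesMemM (d h : ℝ) (c : ℕ → ℂ) : Prop :=
  ∃ f : ℂ → ℂ, MemM d h f ∧ ∀ s : ℂ, 1 < s.re → f s = LSeries c s

end

end SelbergTwist

open SelbergTwist

/-!
Finite Fourier analysis modulo `p` removes the twists from the problem. The coefficients `a(n)χ(n)`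
with `χ ≠ χ₀` are combinations of the `a(n)e(-nb/p)`, `p ∤ b`, through Gauss sums; conversely, by
orthogonality of characters, each `a(n)e(-nb/p)` is a combination of the `a(n)χ(n)`, `χ ≠ χ₀`, and
of one more sequence, `residualTwist`, which is the sum of all the `a(n)e(-nb/p)`. The class
`M(d, h)` is a vector space, so (i) says that the twists by `χ ≠ χ₀` and the residual twist belong
to it (`IsSelberg.linearTwist_mem_iff`). As `a(n)` is multiplicative, the residual twist is
`F(s) (p - 1 - p / F_p(s))` (`IsSelberg.LSeries_residualTwist`), and what remains is that it belongs
to `M(d, h)` exactly when `1 / F_p` is a polynomial in `p^{-s}` of the described kind.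

The functional equation and Stirling's formula show that `|F(σ + it)|` is, up to a power of `|σ|`,
bounded by `|σ|^{d|σ|} (q_F / (2πe)^d)^{|σ|}` as `σ → -∞`, and that this is sharp for `t` in a
bounded interval high enough to avoid the trivial zeros (`IsSelberg.norm_le`, `IsSelberg.le_norm`).
A polynomial of degree `k` in `p^{-s}` contributes a factor `p^{k|σ|}`, and `q_F p^k ≤ h` is the bound
on the degree; this gives (ii) ⟹ (i) (`IsSelberg.residualTwist_mem`).

For (i) ⟹ (ii), let `f` be the continuation of the residual twist. Then `1 / F_p` is an affine
function of `f / F`, so it continues to `σ < 1` with poles at most at the zeros of `F`. It has the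
period `2πi / log p`, so that a pole produces a vertical arithmetic progression of zeros of `F`. For
`σ ≥ 1/2` there is no pole, because `log F_p` converges there, thanks to `b(n) ≪ n^θ` with `θ < 1/2`.
For `σ < 1/2`, all but finitely many of the zeros are reflected to zeros with real part `1 - σ > 1/2`,
which contradicts `N_F(σ', T) = o(T)` (`IsSelberg.exists_ne_zero_of_density`,
`exists_entire_extension`). Hence `1 / F_p(s) = P(p^{-s})` with `P` entire, and the comparison of the
growth of `f` with that of `F` over one period makes `P` a polynomial of degree at most
`log (h / q_F) / log p` (`exists_factorization`). The inverse roots of `P` lie in the closed unit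
disc since `F_p` is holomorphic for `σ > 0` (`IsSelberg.exists_localFactor_eq_prod`).
-/

/-! ### Stirling's formula for the Gamma function on vertical segments -/

namespace SelbergTwist

/-- `x log x - x` is the main term in Stirling's formula; it varies slowly on unit intervals. -/
lemma abs_mul_log_sub_floor_le {x : ℝ} (hx : 1 ≤ x) :
    |(x * Real.log x - x) - ((⌊x⌋₊ : ℝ) * Real.log ⌊x⌋₊ - ⌊x⌋₊)| ≤ Real.log x + 2 := by
  set n : ℝ := (⌊x⌋₊ : ℝ) with hn
  have h1 : (1 : ℝ) ≤ n := by
    rw [hn]; exact_mod_cast Nat.le_floor (by simpa using hx)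
  have h2 : n ≤ x := Nat.floor_le (by linarith)
  have h3 : x < n + 1 := Nat.lt_floor_add_one x
  have hlog : Real.log n ≤ Real.log x := Real.log_le_log (by linarith) h2
  have h0 : 0 ≤ Real.log x := Real.log_nonneg hx
  have hq : n * (Real.log x - Real.log n) ≤ x - n := by
    rw [← Real.log_div (by linarith) (by linarith)]
    have := Real.log_le_sub_one_of_pos (show 0 < x / n by positivity)
    calc n * Real.log (x / n) ≤ n * (x / n - 1) := by gcongr
      _ = x - n := by field_simp
  have hq0 : 0 ≤ n * (Real.log x - Real.log n) := mul_nonneg (by linarith) (by linarith)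
  have h4 : (x - n) * Real.log x ≤ Real.log x := by nlinarith
  have h5 : 0 ≤ (x - n) * Real.log x := mul_nonneg (by linarith) h0
  rw [abs_le]
  constructor <;> nlinarith

lemma log_factorial_sub_isBigO :
    (fun n : ℕ => Real.log (n.factorial : ℝ) - ((n : ℝ) * Real.log n - n)) =O[atTop]
      (fun n : ℕ => Real.log (n : ℝ)) := by
  have hone : (fun _ : ℕ => (1 : ℝ)) =O[atTop] (fun n : ℕ => Real.log (n : ℝ)) :=
    ((Real.isLittleO_const_log_atTop (c := (1 : ℝ))).comp_tendsto tendsto_natCast_atTop_atTop).isBigO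
  have hS : (fun n : ℕ => Real.log (Stirling.stirlingSeq n)) =O[atTop] (fun _ : ℕ => (1 : ℝ)) := by
    have : Tendsto (fun n : ℕ => Real.log (Stirling.stirlingSeq n)) atTop
        (nhds (Real.log (√Real.pi))) :=
      Stirling.tendsto_stirlingSeq_sqrt_pi.log (by positivity)
    exact this.isBigO_one ℝ
  have h : (fun n : ℕ => Real.log (Stirling.stirlingSeq n) + (1 / 2 * Real.log 2
      + 1 / 2 * Real.log (n : ℝ))) =O[atTop] (fun n : ℕ => Real.log (n : ℝ)) :=
    (hS.trans hone).add (((isBigO_const_const (1 / 2 * Real.log 2) (one_ne_zero (α := ℝ)) _).trans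
      hone).add ((isBigO_refl _ _).const_mul_left _))
  refine h.congr' ?_ .rfl
  filter_upwards [eventually_ge_atTop 1] with n hn
  have hn' : (n : ℝ) ≠ 0 := by positivity
  rw [Stirling.log_stirlingSeq_formula, Real.log_mul (by norm_num) hn',
    Real.log_div hn' (Real.exp_pos _).ne', Real.log_exp]
  ring

/-- A weak form of Stirling's formula for the real Gamma function. -/
lemma log_Gamma_sub_isBigO :
    (fun x : ℝ => Real.log (Real.Gamma x) - (x * Real.log x - x)) =O[atTop] Real.log := by
  obtain ⟨C, hC⟩ := (log_factorial_sub_isBigO.comp_tendsto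
    (tendsto_nat_floor_atTop (α := ℝ))).bound
  refine IsBigO.of_bound (|C| + 4) ?_
  filter_upwards [hC, eventually_ge_atTop (3 : ℝ)] with x hx hx3
  simp only [Function.comp, Real.norm_eq_abs] at hx ⊢
  have hb := abs_mul_log_sub_floor_le (show 1 ≤ x by linarith)
  set m : ℕ := ⌊x⌋₊ with hm
  have h1 : 3 ≤ m := Nat.le_floor (by simpa using hx3)
  have h1' : (3 : ℝ) ≤ m := by exact_mod_cast h1
  have h2 : (m : ℝ) ≤ x := Nat.floor_le (by linarith)
  have h3 : x < m + 1 := Nat.lt_floor_add_one x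
  have hl0 : 0 ≤ Real.log m := Real.log_nonneg (by linarith)
  have hlog : Real.log m ≤ Real.log x := Real.log_le_log (by linarith) h2
  have hlog1 : 1 ≤ Real.log x := by
    rw [Real.le_log_iff_exp_le (by linarith)]
    linarith [Real.exp_one_lt_d9]
  have hmono := Real.Gamma_strictMonoOn_Ici.monotoneOn
  have hup : Real.log (Real.Gamma x) ≤ Real.log (m.factorial : ℝ) := by
    rw [← Real.Gamma_nat_eq_factorial]
    exact Real.log_le_log (Real.Gamma_pos_of_pos (by linarith))
      (hmono (by simp; linarith) (by simp; linarith) h3.le)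
  have hlow : Real.log (m.factorial : ℝ) ≤ Real.log (Real.Gamma x) + Real.log m := by
    rw [← Real.log_mul (Real.Gamma_pos_of_pos (by linarith)).ne' (by linarith),
      ← Real.Gamma_nat_eq_factorial, Real.Gamma_add_one (by linarith), mul_comm]
    refine Real.log_le_log (mul_pos (Real.Gamma_pos_of_pos (by linarith)) (by linarith)) ?_
    exact mul_le_mul_of_nonneg_right (hmono (by simp; linarith) (by simp; linarith) h2)
      (by linarith)
  rw [abs_of_nonneg (by linarith : 0 ≤ Real.log x)]
  rw [abs_of_nonneg hl0] at hx
  have hx' : C * Real.log m ≤ |C| * Real.log x := by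
    calc C * Real.log m ≤ |C| * Real.log m := by gcongr; exact le_abs_self C
      _ ≤ _ := by gcongr
  rw [abs_le] at hx hb ⊢
  constructor <;> linarith [hx.1, hx.2, hb.1, hb.2]

lemma norm_GammaSeq_eq {z : ℂ} (n : ℕ) (hn : n ≠ 0) :
    ‖Complex.GammaSeq z n‖ =
      (n : ℝ) ^ z.re * n.factorial / ∏ j ∈ Finset.range (n + 1), ‖z + j‖ := by
  rw [Complex.GammaSeq, norm_div, norm_mul, norm_prod,
    Complex.norm_natCast_cpow_of_pos (Nat.pos_of_ne_zero hn)]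
  simp

/-- Euler's product gives `|Γ(x + iy)| ≤ Γ(x)`. -/
lemma norm_Gamma_le {z : ℂ} (hz : 0 < z.re) : ‖Complex.Gamma z‖ ≤ Real.Gamma z.re := by
  refine le_of_tendsto_of_tendsto (Complex.GammaSeq_tendsto_Gamma z).norm
    (Real.GammaSeq_tendsto_Gamma z.re) ?_
  filter_upwards [eventually_ne_atTop 0] with n hn
  rw [norm_GammaSeq_eq n hn, Real.GammaSeq]
  refine div_le_div_of_nonneg_left (by positivity)
    (Finset.prod_pos fun j _ => by positivity) ?_
  refine Finset.prod_le_prod (fun j _ => by positivity) fun j _ => ?_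
  calc z.re + j = (z + j).re := by simp
    _ ≤ _ := Complex.re_le_norm _

lemma norm_add_natCast_le {z : ℂ} (hz : 1 ≤ z.re) (j : ℕ) :
    ‖z + j‖ ≤ (z.re + j) * Real.exp (z.im ^ 2 * (1 / ((j : ℝ) + 1) ^ 2)) := by
  have hj : (0 : ℝ) ≤ j := by positivity
  have h0 : 0 < z.re + j := by linarith
  set u := z.im ^ 2 * (1 / ((j : ℝ) + 1) ^ 2) with hu
  have hu0 : 0 ≤ u := by positivity
  have h1 : z.im ^ 2 ≤ (z.re + j) ^ 2 * u := by
    rw [hu]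
    have : ((j : ℝ) + 1) ^ 2 ≤ (z.re + j) ^ 2 :=
      pow_le_pow_left₀ (by positivity) (by linarith) 2
    calc z.im ^ 2 = ((j : ℝ) + 1) ^ 2 * (z.im ^ 2 * (1 / ((j : ℝ) + 1) ^ 2)) := by field_simp
      _ ≤ _ := by gcongr
  have h2 : ‖z + j‖ ^ 2 = (z.re + j) ^ 2 + z.im ^ 2 := by
    rw [Complex.sq_norm, Complex.normSq_apply]; simp; ring
  have h3 : 1 + u ≤ Real.exp u := by linarith [Real.add_one_le_exp u]
  have h4 : 1 ≤ Real.exp u := by linarith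
  refine le_of_sq_le_sq ?_ (by positivity) 
  rw [h2, mul_pow]
  calc (z.re + j) ^ 2 + z.im ^ 2 ≤ (z.re + j) ^ 2 * (1 + u) := by nlinarith
    _ ≤ (z.re + j) ^ 2 * Real.exp u := by gcongr
    _ ≤ _ := by gcongr; nlinarith

/-- A lower bound for the Gamma function on vertical segments, uniform in the real part. -/
lemma le_norm_Gamma {z : ℂ} (hz : 1 ≤ z.re) :
    Real.Gamma z.re * Real.exp (-(z.im ^ 2 * ∑' j : ℕ, 1 / ((j : ℝ) + 1) ^ 2)) ≤
      ‖Complex.Gamma z‖ := by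
  have hsum : Summable fun j : ℕ => 1 / ((j : ℝ) + 1) ^ 2 := by
    have := (summable_nat_add_iff 1).2 (Real.summable_one_div_nat_pow.2 one_lt_two)
    simpa using this
  refine le_of_tendsto_of_tendsto ((Real.GammaSeq_tendsto_Gamma z.re).mul_const _)
    (Complex.GammaSeq_tendsto_Gamma z).norm ?_
  filter_upwards [eventually_ne_atTop 0] with n hn
  rw [norm_GammaSeq_eq n hn, Real.GammaSeq]
  have hprod : ∏ j ∈ Finset.range (n + 1), ‖z + j‖ ≤
      (∏ j ∈ Finset.range (n + 1), (z.re + j)) *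
        Real.exp (z.im ^ 2 * ∑' j : ℕ, 1 / ((j : ℝ) + 1) ^ 2) := by
    calc ∏ j ∈ Finset.range (n + 1), ‖z + j‖
        ≤ ∏ j ∈ Finset.range (n + 1),
          ((z.re + j) * Real.exp (z.im ^ 2 * (1 / ((j : ℝ) + 1) ^ 2))) :=
          Finset.prod_le_prod (fun _ _ => norm_nonneg _) fun j _ => norm_add_natCast_le hz j
      _ = (∏ j ∈ Finset.range (n + 1), (z.re + j)) *
          Real.exp (z.im ^ 2 * ∑ j ∈ Finset.range (n + 1), 1 / ((j : ℝ) + 1) ^ 2) := by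
          rw [Finset.prod_mul_distrib, ← Real.exp_sum, Finset.mul_sum]
      _ ≤ _ := by
          gcongr
          exact hsum.sum_le_tsum _ fun j _ => by positivity
  have hpos : 0 < ∏ j ∈ Finset.range (n + 1), ‖z + j‖ := by
    refine Finset.prod_pos fun j _ => norm_pos_iff.2 fun h => ?_
    have := congrArg Complex.re h
    simp at this
    linarith [(Nat.cast_nonneg j : (0 : ℝ) ≤ j)]
  have hpos' : 0 < ∏ j ∈ Finset.range (n + 1), (z.re + j) :=
    Finset.prod_pos fun j _ => by positivity
  rw [Real.exp_neg, ← div_eq_mul_inv, div_div]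
  exact div_le_div_of_nonneg_left (by positivity) hpos hprod

/-- Replacing `λx` by `λx + c` changes the main term in Stirling's formula by `O(log x)`. -/
lemma log_Gamma_linear_isBigO {l : ℝ} (hl : 0 < l) (c : ℝ) :
    (fun x : ℝ => Real.log (Real.Gamma (l * x + c)) -
      (l * (x * Real.log x) + l * (Real.log l - 1) * x)) =O[atTop] Real.log := by
  have hone : ∀ k : ℝ, (fun _ : ℝ => k) =O[atTop] Real.log :=
    fun k => (Real.isLittleO_const_log_atTop (c := k)).isBigO
  have ht : Tendsto (fun x : ℝ => l * x + c) atTop atTop :=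
    tendsto_atTop_add_const_right _ _ (tendsto_id.const_mul_atTop hl)
  have hlog : (fun x : ℝ => Real.log (l * x + c)) =O[atTop] Real.log := by
    refine IsBigO.of_bound 2 ?_
    have h1 := (Real.tendsto_log_atTop).eventually_ge_atTop (Real.log (l + |c| + 1))
    filter_upwards [h1, eventually_ge_atTop 1, ht.eventually_ge_atTop 1] with x hx hx1 hx2
    rw [Real.norm_of_nonneg (Real.log_nonneg hx2), Real.norm_of_nonneg (Real.log_nonneg hx1)]
    have : Real.log (l * x + c) ≤ Real.log ((l + |c| + 1) * x) := by
      refine Real.log_le_log (by linarith) ?_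
      nlinarith [le_abs_self c, abs_nonneg c]
    rw [Real.log_mul (by positivity) (by linarith)] at this
    linarith
  have h1 := (log_Gamma_sub_isBigO.comp_tendsto ht).trans hlog
  have h2 : (fun x : ℝ => l * x * (Real.log (l * x + c) - Real.log (l * x))) =O[atTop]
      Real.log := by
    refine IsBigO.trans ?_ (hone 1)
    refine IsBigO.of_bound (2 * |c|) ?_
    filter_upwards [eventually_gt_atTop 0, ht.eventually_ge_atTop 1,
      eventually_ge_atTop (2 * |c| / l)] with x hx hx2 hx3
    have hlx : 0 < l * x := by positivity
    have hc2 : 2 * |c| ≤ l * x := by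
      rw [div_le_iff₀ hl] at hx3; linarith
    have habs := neg_abs_le c
    have habs' := le_abs_self c
    rw [norm_one, mul_one, Real.norm_eq_abs, abs_le]
    have e1 : Real.log (l * x + c) - Real.log (l * x) ≤ c / (l * x) := by
      rw [← Real.log_div (by linarith) hlx.ne']
      refine (Real.log_le_sub_one_of_pos (by apply div_pos <;> linarith)).trans (le_of_eq ?_)
      field_simp; ring
    have e2 : c / (l * x + c) ≤ Real.log (l * x + c) - Real.log (l * x) := by
      rw [← Real.log_div (by linarith) hlx.ne', ← neg_le_neg_iff, ← Real.log_inv, inv_div]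
      refine (Real.log_le_sub_one_of_pos (by apply div_pos <;> linarith)).trans (le_of_eq ?_)
      have : l * x + c ≠ 0 := by linarith
      field_simp; ring
    constructor
    · have : l * x * (c / (l * x + c)) ≥ -(2 * |c|) := by
        rw [mul_div_assoc', ge_iff_le, le_div_iff₀ (by linarith)]
        nlinarith [abs_nonneg c]
      nlinarith [mul_le_mul_of_nonneg_left e2 hlx.le]
    · have : l * x * (c / (l * x)) = c := by field_simp
      nlinarith [mul_le_mul_of_nonneg_left e1 hlx.le]
  have h3 := h1.add (h2.add ((hlog.const_mul_left c).sub (hone c)))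
  refine h3.congr' ?_ .rfl
  filter_upwards [eventually_gt_atTop 0] with x hx
  simp only [Function.comp]
  rw [Real.log_mul hl.ne' hx.ne']
  ring

/-- Stirling's formula, with an error `O(log x)`, along `Re z = λx + c`, uniformly for bounded
imaginary part. -/
lemma abs_log_norm_Gamma_sub_le {l : ℝ} (hl : 0 < l) (c B : ℝ) :
    ∃ C : ℝ, ∀ᶠ x : ℝ in atTop, ∀ z : ℂ, z.re = l * x + c → |z.im| ≤ B →
      |Real.log ‖Complex.Gamma z‖ - (l * (x * Real.log x) + l * (Real.log l - 1) * x)| ≤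
        C * Real.log x := by
  obtain ⟨C, hC⟩ := (log_Gamma_linear_isBigO hl c).bound
  set S := ∑' j : ℕ, 1 / ((j : ℝ) + 1) ^ 2
  have hS : 0 ≤ S := tsum_nonneg fun j => by positivity
  have ht : Tendsto (fun x : ℝ => l * x + c) atTop atTop :=
    tendsto_atTop_add_const_right _ _ (tendsto_id.const_mul_atTop hl)
  refine ⟨C + B ^ 2 * S, ?_⟩
  filter_upwards [hC, ht.eventually_ge_atTop 1, Real.tendsto_log_atTop.eventually_ge_atTop 1]
    with x hx h1 hlog z hz hzB
  have hz1 : 1 ≤ z.re := by rw [hz]; exact h1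
  have hG : 0 < Real.Gamma z.re := Real.Gamma_pos_of_pos (by linarith)
  have hup := norm_Gamma_le (z := z) (by linarith)
  have hlow := le_norm_Gamma hz1
  have hpos : 0 < ‖Complex.Gamma z‖ := lt_of_lt_of_le (by positivity) hlow
  have hup' := Real.log_le_log hpos hup
  have hlow' := Real.log_le_log (by positivity) hlow
  rw [Real.log_mul hG.ne' (Real.exp_pos _).ne', Real.log_exp] at hlow'
  have hB2 : z.im ^ 2 * S ≤ B ^ 2 * S * Real.log x := by
    have : z.im ^ 2 ≤ B ^ 2 := by
      rw [← sq_abs z.im]; gcongr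
    calc z.im ^ 2 * S ≤ B ^ 2 * S := by gcongr
      _ ≤ _ := le_mul_of_one_le_right (by positivity) hlog
  rw [Real.norm_eq_abs, Real.norm_of_nonneg (by linarith : 0 ≤ Real.log x), ← hz] at hx
  have hBS : 0 ≤ B ^ 2 * S * Real.log x := by positivity
  rw [abs_le] at hx ⊢
  constructor <;> linarith [hx.1, hx.2]

end SelbergTwist

/-! ### Growth of `F` to the left of the critical strip -/

namespace SelbergTwist

lemma norm_sin_le (z : ℂ) : ‖Complex.sin z‖ ≤ Real.exp |z.im| := by
  have h : ‖Complex.sin z‖ = ‖Complex.exp (-z * Complex.I) - Complex.exp (z * Complex.I)‖ / 2 := by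
    rw [Complex.sin, norm_div, norm_mul]; simp
  have h1 : ‖Complex.exp (-z * Complex.I)‖ ≤ Real.exp |z.im| := by
    rw [Complex.norm_exp]; simpa using le_abs_self z.im
  have h2 : ‖Complex.exp (z * Complex.I)‖ ≤ Real.exp |z.im| := by
    rw [Complex.norm_exp]; simpa using neg_le_abs z.im
  rw [h]
  linarith [norm_sub_le (Complex.exp (-z * Complex.I)) (Complex.exp (z * Complex.I))]

lemma abs_im_le_norm_sin (z : ℂ) : |z.im| ≤ ‖Complex.sin z‖ := by
  have h : ‖Complex.sin z‖ = ‖Complex.exp (-z * Complex.I) - Complex.exp (z * Complex.I)‖ / 2 := by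
    rw [Complex.sin, norm_div, norm_mul]; simp
  have h1 : ‖Complex.exp (-z * Complex.I)‖ = Real.exp z.im := by
    rw [Complex.norm_exp]; simp
  have h2 : ‖Complex.exp (z * Complex.I)‖ = Real.exp (-z.im) := by
    rw [Complex.norm_exp]; simp
  have h3 := abs_norm_sub_norm_le (Complex.exp (-z * Complex.I)) (Complex.exp (z * Complex.I))
  rw [h1, h2] at h3
  have h4 : |z.im| ≤ |Real.sinh z.im| := by
    rw [Real.abs_sinh]; exact Real.self_le_sinh_iff.2 (abs_nonneg _)
  rw [Real.sinh_eq, abs_div, abs_two] at h4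
  rw [h]; linarith

variable {a : ℕ → ℂ} {F : ℂ → ℂ} {D : FunctionalEquationData}

lemma IsSelberg.differentiableAt (hF : IsSelberg a F D) {s : ℂ} (hs : s ≠ 1) :
    DifferentiableAt ℂ F s := by
  obtain ⟨m, G, hG, -, hGF⟩ := hF.continuation
  have h : DifferentiableAt ℂ (fun s => G s / (s - 1) ^ m) s :=
    (hG s).div (by fun_prop) (pow_ne_zero _ (sub_ne_zero.2 hs))
  refine h.congr_of_eventuallyEq ?_
  filter_upwards [isOpen_ne.mem_nhds hs] with w hw
  rw [hGF w hw, mul_div_cancel_left₀ _ (pow_ne_zero _ (sub_ne_zero.2 hw))]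

lemma IsSelberg.meromorphicAt (hF : IsSelberg a F D) (s : ℂ) : MeromorphicAt F s := by
  obtain ⟨m, G, hG, -, hGF⟩ := hF.continuation
  have h : MeromorphicAt (fun s => G s / (s - 1) ^ m) s :=
    (hG.analyticAt s).meromorphicAt.div (by fun_prop)
  refine h.congr ?_
  have : ∀ᶠ w in nhdsWithin s {s}ᶜ, w ≠ 1 := by
    by_cases hs : s = 1
    · subst hs; exact eventually_mem_nhdsWithin
    · exact mem_nhdsWithin_of_mem_nhds (isOpen_ne.mem_nhds hs)
  filter_upwards [this] with w hw
  rw [hGF w hw, mul_div_cancel_left₀ _ (pow_ne_zero _ (sub_ne_zero.2 hw))]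

lemma IsSelberg.ne_zero (hF : IsSelberg a F D) {s : ℂ} (hs : 1 < s.re) : F s ≠ 0 := by
  obtain ⟨b, -, -, -, -, -, h⟩ := hF.euler
  rw [(h s hs).2]; exact Complex.exp_ne_zero _

/-- The logarithm of `|F|` is bounded on `σ ≥ 2`. -/
lemma IsSelberg.abs_log_norm_le (hF : IsSelberg a F D) :
    ∃ K : ℝ, ∀ s : ℂ, 2 ≤ s.re → |Real.log ‖F s‖| ≤ K := by
  obtain ⟨b, -, -, -, -, -, h⟩ := hF.euler
  refine ⟨∑' n, ‖LSeries.term b 2 n‖, fun s hs => ?_⟩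
  have h2 := (h 2 (by norm_num)).1
  rw [(h s (by linarith)).2, Complex.norm_exp, Real.log_exp]
  refine (Complex.abs_re_le_norm _).trans ?_
  have hle : ∀ n, ‖LSeries.term b s n‖ ≤ ‖LSeries.term b 2 n‖ :=
    LSeries.norm_term_le_of_re_le_re b (by simpa using hs)
  exact (norm_tsum_le_tsum_norm (h2.norm.of_nonneg_of_le (fun _ => norm_nonneg _) hle)).trans
    ((h2.norm.of_nonneg_of_le (fun _ => norm_nonneg _) hle).tsum_le_tsum hle h2.norm)

lemma FunctionalEquationData.dense_gammaRegular (D : FunctionalEquationData) :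
    Dense {s : ℂ | D.GammaRegular s} := by
  have hc : (⋃ j : Fin D.r, Set.range fun n : ℕ => (-(n : ℂ) - D.mu j) / D.lam j).Countable :=
    Set.countable_iUnion fun j => Set.countable_range _
  refine (hc.dense_compl ℝ).mono ?_
  intro s hs j n hjn
  refine hs ?_
  refine Set.mem_iUnion.2 ⟨j, n, ?_⟩
  have : (D.lam j : ℂ) ≠ 0 := by exact_mod_cast (D.lam_pos j).ne'
  simp only
  rw [← hjn]
  field_simp; ring

/-- To the right of the imaginary axis no Gamma factor is singular. -/
lemma FunctionalEquationData.gammaRegular_of_re_pos (D : FunctionalEquationData) {s : ℂ}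
    (hs : 0 < s.re) : D.GammaRegular s := by
  intro j n h
  have := congrArg Complex.re h
  simp at this
  have h1 := mul_pos (D.lam_pos j) hs
  have h2 := D.mu_re_nonneg j
  linarith [(Nat.cast_nonneg n : (0 : ℝ) ≤ n)]

lemma one_sub_conj_re (s : ℂ) : (1 - (starRingEnd ℂ) s).re = 1 - s.re := by simp

lemma one_sub_conj_im (s : ℂ) : (1 - (starRingEnd ℂ) s).im = s.im := by simp

/-- The right-hand side of the asymmetric functional equation, in absolute value and without the
sine factors, after `1 / Γ(z) = Γ(1 - z) sin(πz) / π` has been applied to the Gamma factors at `s`. -/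
noncomputable def gammaPart (F : ℂ → ℂ) (D : FunctionalEquationData) (s : ℂ) : ℝ :=
  D.Q ^ (1 - 2 * s.re) *
    (∏ j, (‖Complex.Gamma (D.lam j * (1 - (starRingEnd ℂ) s) + D.mu j)‖ *
      ‖Complex.Gamma (1 - (D.lam j * s + D.mu j))‖ / Real.pi)) * ‖F (1 - (starRingEnd ℂ) s)‖

/-- The half plane on which the reflected Gamma factors `Γ(1 - λ_j s - μ_j)` are regular. -/
def leftRegion (D : FunctionalEquationData) : Set ℂ :=
  {s : ℂ | s.re < 0 ∧ ∀ j, D.lam j * s.re + (D.mu j).re < 1}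

lemma isOpen_leftRegion (D : FunctionalEquationData) : IsOpen (leftRegion D) := by
  have : leftRegion D = {s : ℂ | s.re < 0} ∩ ⋂ j, {s : ℂ | D.lam j * s.re + (D.mu j).re < 1} := by
    ext s; simp [leftRegion]
  rw [this]
  refine (isOpen_lt (by fun_prop) (by fun_prop)).inter (isOpen_iInter_of_finite fun j => ?_)
  exact isOpen_lt (by fun_prop) (by fun_prop)

lemma IsSelberg.norm_eq_of_gammaRegular (hF : IsSelberg a F D) {s : ℂ} (hs : s ∈ leftRegion D)
    (hr : D.GammaRegular s) :
    ‖F s‖ = gammaPart F D s * ∏ j, ‖Complex.sin (Real.pi * (D.lam j * s + D.mu j))‖ := by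
  have h0 : s ≠ 0 := by rintro rfl; simpa using hs.1
  have h1 : s ≠ 1 := by rintro rfl; have := hs.1; norm_num at this
  have hr' : D.GammaRegular (1 - (starRingEnd ℂ) s) :=
    D.gammaRegular_of_re_pos (by rw [one_sub_conj_re]; linarith [hs.1])
  have key := congrArg norm (hF.functional_equation s h0 h1 hr hr')
  simp only [FunctionalEquationData.completed, norm_mul, D.norm_omega, one_mul,
    RCLike.norm_conj, norm_prod, Complex.norm_cpow_eq_rpow_re_of_pos D.Q_pos,
    one_sub_conj_re] at key
  have hG : ∀ j, ‖Complex.Gamma (D.lam j * s + D.mu j)‖ *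
      (‖Complex.Gamma (1 - (D.lam j * s + D.mu j))‖ / Real.pi *
        ‖Complex.sin (Real.pi * (D.lam j * s + D.mu j))‖) = 1 := by
    intro j
    have hz1 : (D.lam j * s + D.mu j).re < 1 := by simpa using hs.2 j
    have hzn := hr j
    set z := D.lam j * s + D.mu j with hz
    have hsin : Complex.sin (Real.pi * z) ≠ 0 := by
      intro h
      rw [Complex.sin_eq_zero_iff] at h
      obtain ⟨k, hk⟩ := h
      have hpi : (Real.pi : ℂ) ≠ 0 := by exact_mod_cast Real.pi_ne_zero
      -- a zero of the sine with `Re z < 1` is an integer `k ≤ 0`, that is, a pole of `Γ`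
      have hzk : z = k := by
        rw [mul_comm] at hk; exact mul_right_cancel₀ hpi hk
      rw [hzk, Complex.intCast_re] at hz1
      have hk1 : k < 1 := by exact_mod_cast hz1
      refine hzn (-k).toNat ?_
      have hk2 : (((-k).toNat : ℤ) : ℂ) = ((-k : ℤ) : ℂ) := by
        rw [Int.toNat_of_nonneg (by omega)]
      rw [hzk, ← Int.cast_natCast, hk2]; simp
    have := congrArg norm (Complex.Gamma_mul_Gamma_one_sub z)
    rw [norm_mul, norm_div, Complex.norm_real, Real.norm_of_nonneg Real.pi_pos.le] at this
    have hs' : ‖Complex.sin (Real.pi * z)‖ ≠ 0 := norm_ne_zero_iff.2 hsin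
    calc _ = (‖Complex.Gamma z‖ * ‖Complex.Gamma (1 - z)‖) *
          ‖Complex.sin (Real.pi * z)‖ / Real.pi := by ring
      _ = 1 := by rw [this]; field_simp
  have hprod : (∏ j, ‖Complex.Gamma (D.lam j * s + D.mu j)‖) *
      ((∏ j, ‖Complex.Gamma (1 - (D.lam j * s + D.mu j))‖ / Real.pi) *
        ∏ j, ‖Complex.sin (Real.pi * (D.lam j * s + D.mu j))‖) = 1 := by
    rw [← Finset.prod_mul_distrib, ← Finset.prod_mul_distrib]
    exact Finset.prod_eq_one fun j _ => hG j
  have hQ : D.Q ^ (1 - 2 * s.re) * D.Q ^ s.re = D.Q ^ (1 - s.re) := by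
    rw [← Real.rpow_add D.Q_pos]; ring_nf
  have hQ0 : D.Q ^ s.re ≠ 0 := (Real.rpow_pos_of_pos D.Q_pos _).ne'
  refine mul_left_cancel₀ hQ0 ?_
  rw [gammaPart]
  simp only [mul_div_assoc, Finset.prod_mul_distrib]
  calc _ = (D.Q ^ s.re * (∏ j, ‖Complex.Gamma (D.lam j * s + D.mu j)‖) * ‖F s‖) *
        ((∏ j, ‖Complex.Gamma (1 - (D.lam j * s + D.mu j))‖ / Real.pi) *
        ∏ j, ‖Complex.sin (Real.pi * (D.lam j * s + D.mu j))‖) := by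
        linear_combination -(D.Q ^ s.re * ‖F s‖) * hprod
    _ = _ := by
        rw [key, ← hQ]; ring

/-- The asymmetric form of the functional equation, in absolute value. By continuity it also holds
at the poles of the Gamma factors. -/
lemma IsSelberg.norm_eq (hF : IsSelberg a F D) {s : ℂ} (hs : s ∈ leftRegion D) :
    ‖F s‖ = gammaPart F D s * ∏ j, ‖Complex.sin (Real.pi * (D.lam j * s + D.mu j))‖ := by
  have hcl : s ∈ closure (leftRegion D ∩ {s : ℂ | D.GammaRegular s}) :=
    D.dense_gammaRegular.open_subset_closure_inter (isOpen_leftRegion D) hs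
  have hc1 : ContinuousOn (fun s => ‖F s‖) (leftRegion D) := by
    intro w hw
    refine ((hF.differentiableAt ?_).continuousAt.norm).continuousWithinAt
    rintro rfl; have := hw.1; norm_num at this
  have hc2 : ContinuousOn (fun s => gammaPart F D s *
      ∏ j, ‖Complex.sin (Real.pi * (D.lam j * s + D.mu j))‖) (leftRegion D) := by
    intro w hw
    refine ContinuousAt.continuousWithinAt ?_
    have hw1 : 1 < (1 - (starRingEnd ℂ) w).re := by rw [one_sub_conj_re]; linarith [hw.1]
    have hFc : ContinuousAt (fun s => F (1 - (starRingEnd ℂ) s)) w :=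
      ContinuousAt.comp (f := fun s => 1 - (starRingEnd ℂ) s) (g := F)
        (hF.differentiableAt (by intro h; rw [h] at hw1; norm_num at hw1)).continuousAt
        (by fun_prop)
    have hg1 : ∀ j, ContinuousAt
        (fun s => Complex.Gamma (D.lam j * (1 - (starRingEnd ℂ) s) + D.mu j)) w := fun j =>
      ContinuousAt.comp (f := fun s => D.lam j * (1 - (starRingEnd ℂ) s) + D.mu j)
        (g := Complex.Gamma) (Complex.differentiableAt_Gamma _ fun m =>
          D.gammaRegular_of_re_pos (by linarith) j m).continuousAt (by fun_prop)
    have hg2 : ∀ j, ContinuousAt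
        (fun s => Complex.Gamma (1 - (D.lam j * s + D.mu j))) w := fun j => by
      refine ContinuousAt.comp (f := fun s => 1 - (D.lam j * s + D.mu j))
        (g := Complex.Gamma) (Complex.differentiableAt_Gamma _ fun m hm => ?_).continuousAt
        (by fun_prop)
      have := congrArg Complex.re hm
      simp at this
      linarith [hw.2 j, (Nat.cast_nonneg m : (0 : ℝ) ≤ m)]
    unfold gammaPart
    refine ContinuousAt.mul (ContinuousAt.mul (ContinuousAt.mul ?_ ?_) hFc.norm) ?_
    · exact ContinuousAt.rpow continuousAt_const (by fun_prop) (Or.inl D.Q_pos.ne')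
    · exact tendsto_finsetProd _ fun j _ => (((hg1 j).norm.mul (hg2 j).norm).div_const _)
    · fun_prop
  have heq : Set.EqOn (fun s => ‖F s‖) (fun s => gammaPart F D s *
      ∏ j, ‖Complex.sin (Real.pi * (D.lam j * s + D.mu j))‖)
      (leftRegion D ∩ {s : ℂ | D.GammaRegular s}) :=
    fun w hw => hF.norm_eq_of_gammaRegular hw.1 hw.2
  exact heq.of_subset_closure hc1 hc2 Set.inter_subset_left
    (D.dense_gammaRegular.open_subset_closure_inter (isOpen_leftRegion D)) hs

/-- The logarithm of `|σ|^{d|σ|} (h / (2πe)^d)^{|σ|}` at `x = |σ|`. -/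
noncomputable def mainTerm (d h x : ℝ) : ℝ :=
  d * (x * Real.log x) + Real.log (h / (2 * Real.pi * Real.exp 1) ^ d) * x

lemma FunctionalEquationData.conductor_pos (D : FunctionalEquationData) : 0 < D.conductor := by
  have h := D.Q_pos
  have h2 : 0 < ∏ j, D.lam j ^ (2 * D.lam j) :=
    Finset.prod_pos fun j _ => Real.rpow_pos_of_pos (D.lam_pos j) _
  unfold FunctionalEquationData.conductor
  have := Real.pi_pos
  positivity

lemma mainTerm_conductor (D : FunctionalEquationData) (x : ℝ) :
    mainTerm D.degree D.conductor x = 2 * x * Real.log D.Q +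
      ∑ j, 2 * (D.lam j * (x * Real.log x) + D.lam j * (Real.log (D.lam j) - 1) * x) := by
  have hpi := Real.pi_pos
  have hlogq : Real.log D.conductor = D.degree * Real.log (2 * Real.pi) + 2 * Real.log D.Q +
      ∑ j, 2 * D.lam j * Real.log (D.lam j) := by
    have hne : ∏ j, D.lam j ^ (2 * D.lam j) ≠ 0 :=
      Finset.prod_ne_zero_iff.2 fun j _ => (Real.rpow_pos_of_pos (D.lam_pos j) _).ne'
    rw [FunctionalEquationData.conductor, Real.log_mul _ hne, Real.log_mul, Real.log_rpow,
      Real.log_pow, Real.log_prod]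
    · congr 1
      exact Finset.sum_congr rfl fun j _ => Real.log_rpow (D.lam_pos j) _
    · exact fun j _ => (Real.rpow_pos_of_pos (D.lam_pos j) _).ne'
    · positivity
    · positivity
    · exact pow_ne_zero _ D.Q_pos.ne'
    · exact mul_ne_zero (by positivity) (pow_ne_zero _ D.Q_pos.ne')
  rw [mainTerm, Real.log_div D.conductor_pos.ne' (by positivity), Real.log_rpow (by positivity),
    Real.log_mul (by positivity) (Real.exp_pos 1).ne', Real.log_exp, hlogq]
  have : ∑ j, 2 * (D.lam j * (x * Real.log x) + D.lam j * (Real.log (D.lam j) - 1) * x) =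
      D.degree * (x * Real.log x) + (∑ j, 2 * D.lam j * Real.log (D.lam j)) * x
        - D.degree * x := by
    simp only [FunctionalEquationData.degree, Finset.mul_sum, Finset.sum_mul]
    rw [← Finset.sum_add_distrib, ← Finset.sum_sub_distrib]
    exact Finset.sum_congr rfl fun j _ => by ring
  rw [this]; ring

/-- Stirling's formula turns the Gamma factors into the main term attached to degree and
conductor. -/
lemma IsSelberg.abs_log_gammaPart_sub_le (hF : IsSelberg a F D) (A B : ℝ) :
    ∃ C : ℝ, ∀ᶠ x : ℝ in atTop, ∀ t ∈ Set.Icc A B, 0 < gammaPart F D (-x + t * Complex.I) ∧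
      |Real.log (gammaPart F D (-x + t * Complex.I)) - mainTerm D.degree D.conductor x| ≤
        C * Real.log x := by
  obtain ⟨K, hK⟩ := hF.abs_log_norm_le
  set T : Fin D.r → ℝ := fun j => D.lam j * max |A| |B| + |(D.mu j).im|
  choose C1 hC1 using fun j =>
    abs_log_norm_Gamma_sub_le (D.lam_pos j) (D.lam j + (D.mu j).re) (T j)
  choose C2 hC2 using fun j => abs_log_norm_Gamma_sub_le (D.lam_pos j) (1 - (D.mu j).re) (T j)
  have hre : ∀ᶠ x : ℝ in atTop, ∀ j, 0 < D.lam j * x + (1 - (D.mu j).re) :=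
    eventually_all.2 fun j => (tendsto_atTop_add_const_right _ _
      (tendsto_id.const_mul_atTop (D.lam_pos j))).eventually_gt_atTop 0
  refine ⟨(∑ j, (C1 j + C2 j)) + (|Real.log D.Q| + K + ∑ _j : Fin D.r, |Real.log Real.pi|), ?_⟩
  filter_upwards [eventually_all.2 hC1, eventually_all.2 hC2, hre, eventually_ge_atTop 1,
    Real.tendsto_log_atTop.eventually_ge_atTop 1] with x h1 h2 hre hx hlog t ht
  set s : ℂ := -x + t * Complex.I with hs
  have hsre : s.re = -x := by simp [hs]
  have hsim : s.im = t := by simp [hs]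
  have htT : |t| ≤ max |A| |B| := abs_le_max_abs_abs ht.1 ht.2
  have him : ∀ j, |D.lam j * t + (D.mu j).im| ≤ T j := fun j => by
    refine (abs_add_le _ _).trans ?_
    rw [abs_mul, abs_of_pos (D.lam_pos j)]
    have := mul_le_mul_of_nonneg_left htT (D.lam_pos j).le
    simp only [T]; linarith
  have e1 := fun j => h1 j (D.lam j * (1 - (starRingEnd ℂ) s) + D.mu j)
    (by simp [hsre]; ring) (by simpa [hsim] using him j)
  have e2 := fun j => h2 j (1 - (D.lam j * s + D.mu j))
    (by simp [hsre]; ring)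
    (by
      have : (1 - (D.lam j * s + D.mu j)).im = -(D.lam j * t + (D.mu j).im) := by
        simp [hsim]
      rw [this, abs_neg]; exact him j)
  have p1 : ∀ j, 0 < ‖Complex.Gamma (D.lam j * (1 - (starRingEnd ℂ) s) + D.mu j)‖ := fun j =>
    norm_pos_iff.2 (Complex.Gamma_ne_zero_of_re_pos (by
      simp [hsre]
      nlinarith [D.lam_pos j, D.mu_re_nonneg j]))
  have p2 : ∀ j, 0 < ‖Complex.Gamma (1 - (D.lam j * s + D.mu j))‖ := fun j =>
    norm_pos_iff.2 (Complex.Gamma_ne_zero_of_re_pos (by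
      simp [hsre]; linarith [hre j]))
  have hs2 : 2 ≤ (1 - (starRingEnd ℂ) s).re := by rw [one_sub_conj_re, hsre]; linarith
  have p3 : 0 < ‖F (1 - (starRingEnd ℂ) s)‖ := norm_pos_iff.2 (hF.ne_zero (by linarith))
  have hpi := Real.pi_pos
  have p4 : ∀ j, 0 < ‖Complex.Gamma (D.lam j * (1 - (starRingEnd ℂ) s) + D.mu j)‖ *
      ‖Complex.Gamma (1 - (D.lam j * s + D.mu j))‖ / Real.pi := fun j =>
    div_pos (mul_pos (p1 j) (p2 j)) hpi
  have p5 := Finset.prod_pos fun j (_ : j ∈ Finset.univ) => p4 j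
  have p6 := Real.rpow_pos_of_pos D.Q_pos (1 - 2 * s.re)
  refine ⟨mul_pos (mul_pos p6 p5) p3, ?_⟩
  have hlogP : Real.log (gammaPart F D s) = (1 + 2 * x) * Real.log D.Q +
      (∑ j, (Real.log ‖Complex.Gamma (D.lam j * (1 - (starRingEnd ℂ) s) + D.mu j)‖ +
        Real.log ‖Complex.Gamma (1 - (D.lam j * s + D.mu j))‖ - Real.log Real.pi)) +
      Real.log ‖F (1 - (starRingEnd ℂ) s)‖ := by
    rw [gammaPart, Real.log_mul (mul_pos p6 p5).ne' p3.ne', Real.log_mul p6.ne' p5.ne',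
      Real.log_rpow D.Q_pos, hsre, Real.log_prod fun j _ => (p4 j).ne']
    congr 2
    · ring
    · refine Finset.sum_congr rfl fun j _ => ?_
      rw [Real.log_div (mul_pos (p1 j) (p2 j)).ne' hpi.ne', Real.log_mul (p1 j).ne' (p2 j).ne']
  set g1 : Fin D.r → ℝ :=
    fun j => Real.log ‖Complex.Gamma (D.lam j * (1 - (starRingEnd ℂ) s) + D.mu j)‖
  set g2 : Fin D.r → ℝ := fun j => Real.log ‖Complex.Gamma (1 - (D.lam j * s + D.mu j))‖
  set E : Fin D.r → ℝ :=
    fun j => D.lam j * (x * Real.log x) + D.lam j * (Real.log (D.lam j) - 1) * x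
  have hdiff : Real.log (gammaPart F D s) - mainTerm D.degree D.conductor x =
      (∑ j, ((g1 j - E j) + (g2 j - E j))) + (Real.log D.Q +
        Real.log ‖F (1 - (starRingEnd ℂ) s)‖ - ∑ _j : Fin D.r, Real.log Real.pi) := by
    rw [hlogP, mainTerm_conductor]
    simp only [Finset.sum_add_distrib, Finset.sum_sub_distrib, ← Finset.mul_sum, g1, g2, E]
    ring
  rw [hdiff, add_mul, Finset.sum_mul]
  refine (abs_add_le _ _).trans (add_le_add ?_ ?_)
  · refine (Finset.abs_sum_le_sum_abs _ _).trans (Finset.sum_le_sum fun j _ => ?_)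
    rw [add_mul]
    exact (abs_add_le _ _).trans (add_le_add (e1 j) (e2 j))
  · have hsum : |∑ _j : Fin D.r, Real.log Real.pi| ≤ ∑ _j : Fin D.r, |Real.log Real.pi| :=
      Finset.abs_sum_le_sum_abs _ _
    have hKs := hK _ hs2
    have h0 : |Real.log D.Q + Real.log ‖F (1 - (starRingEnd ℂ) s)‖ -
        ∑ _j : Fin D.r, Real.log Real.pi| ≤
        |Real.log D.Q| + K + ∑ _j : Fin D.r, |Real.log Real.pi| :=
      (abs_sub _ _).trans (add_le_add ((abs_add_le _ _).trans (by linarith)) hsum)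
    exact h0.trans (le_mul_of_one_le_right ((abs_nonneg _).trans h0) hlog)

lemma eventually_mem_leftRegion (D : FunctionalEquationData) :
    ∀ᶠ x : ℝ in atTop, ∀ t : ℝ, (-x + t * Complex.I : ℂ) ∈ leftRegion D := by
  have hre : ∀ᶠ x : ℝ in atTop, ∀ j, 0 < D.lam j * x + (1 - (D.mu j).re) :=
    eventually_all.2 fun j => (tendsto_atTop_add_const_right _ _
      (tendsto_id.const_mul_atTop (D.lam_pos j))).eventually_gt_atTop 0
  filter_upwards [hre, eventually_gt_atTop 0] with x hx hx0 t
  refine ⟨by simpa using hx0, fun j => ?_⟩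
  have := hx j
  simp; linarith

/-- Upper bound for `F` far to the left, on a horizontal strip. -/
lemma IsSelberg.norm_le (hF : IsSelberg a F D) (A B : ℝ) :
    ∃ C : ℝ, ∀ᶠ x : ℝ in atTop, ∀ t ∈ Set.Icc A B,
      ‖F (-x + t * Complex.I)‖ ≤
        Real.exp (mainTerm D.degree D.conductor x + C * Real.log x) := by
  obtain ⟨C, hC⟩ := hF.abs_log_gammaPart_sub_le A B
  set T : ℝ := ∑ j, Real.pi * (D.lam j * max |A| |B| + |(D.mu j).im|)
  have hpi := Real.pi_pos
  have hT : 0 ≤ T := Finset.sum_nonneg fun j _ => by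
    have := (D.lam_pos j).le
    have : 0 ≤ max |A| |B| := (abs_nonneg A).trans (le_max_left _ _)
    positivity
  refine ⟨C + T, ?_⟩
  filter_upwards [hC, eventually_mem_leftRegion D,
    Real.tendsto_log_atTop.eventually_ge_atTop 1] with x hx hreg hlog t ht
  obtain ⟨hpos, hx⟩ := hx t ht
  rw [hF.norm_eq (hreg t)]
  have h1 : gammaPart F D (-x + t * Complex.I) ≤
      Real.exp (mainTerm D.degree D.conductor x + C * Real.log x) := by
    rw [← Real.log_le_iff_le_exp hpos]
    linarith [(abs_le.1 hx).2]
  have h2 : ∏ j, ‖Complex.sin (Real.pi * (D.lam j * (-x + t * Complex.I) + D.mu j))‖ ≤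
      Real.exp (T * Real.log x) := by
    calc _ ≤ ∏ j, Real.exp (Real.pi * (D.lam j * max |A| |B| + |(D.mu j).im|)) := by
          refine Finset.prod_le_prod (fun _ _ => norm_nonneg _) fun j _ =>
            (norm_sin_le _).trans (Real.exp_le_exp.2 ?_)
          have htT : |t| ≤ max |A| |B| := abs_le_max_abs_abs ht.1 ht.2
          have : ((Real.pi : ℂ) * (D.lam j * (-x + t * Complex.I) + D.mu j)).im =
              Real.pi * (D.lam j * t + (D.mu j).im) := by simp
          rw [this, abs_mul, abs_of_pos hpi]
          refine mul_le_mul_of_nonneg_left ((abs_add_le _ _).trans ?_) hpi.le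
          rw [abs_mul, abs_of_pos (D.lam_pos j)]
          have := mul_le_mul_of_nonneg_left htT (D.lam_pos j).le
          linarith
      _ = Real.exp T := by rw [← Real.exp_sum]
      _ ≤ _ := Real.exp_le_exp.2 (le_mul_of_one_le_right hT hlog)
  calc _ ≤ Real.exp (mainTerm D.degree D.conductor x + C * Real.log x) *
        Real.exp (T * Real.log x) :=
        mul_le_mul h1 h2 (Finset.prod_nonneg fun _ _ => norm_nonneg _) (Real.exp_pos _).le
    _ = _ := by rw [← Real.exp_add]; ring_nf

/-- High enough in the upper half plane there are no trivial zeros, and the upper bound for `F` is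
sharp up to a power of `|σ|`. -/
lemma IsSelberg.le_norm (hF : IsSelberg a F D) :
    ∃ A₀ : ℝ, ∀ A B : ℝ, A₀ ≤ A → ∃ C : ℝ, ∀ᶠ x : ℝ in atTop, ∀ t ∈ Set.Icc A B,
      Real.exp (mainTerm D.degree D.conductor x - C * Real.log x) ≤
        ‖F (-x + t * Complex.I)‖ := by
  -- for `t ≥ A₀` every `λ_j t + Im μ_j` is at least `1`, so that the sine factors are `≥ 1`
  refine ⟨∑ j, (1 + |(D.mu j).im|) / D.lam j, fun A B hA => ?_⟩
  obtain ⟨C, hC⟩ := hF.abs_log_gammaPart_sub_le A B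
  refine ⟨C, ?_⟩
  filter_upwards [hC, eventually_mem_leftRegion D] with x hx hreg t ht
  obtain ⟨hpos, hx⟩ := hx t ht
  rw [hF.norm_eq (hreg t)]
  have h1 : Real.exp (mainTerm D.degree D.conductor x - C * Real.log x) ≤
      gammaPart F D (-x + t * Complex.I) := by
    rw [← Real.le_log_iff_exp_le hpos]
    linarith [(abs_le.1 hx).1]
  have h2 : 1 ≤ ∏ j, ‖Complex.sin (Real.pi * (D.lam j * (-x + t * Complex.I) + D.mu j))‖ := by
    refine Finset.prod_const_one.symm.le.trans
      (Finset.prod_le_prod (fun _ _ => zero_le_one) fun j _ => ?_)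
    refine le_trans ?_ (abs_im_le_norm_sin _)
    have him : ((Real.pi : ℂ) * (D.lam j * (-x + t * Complex.I) + D.mu j)).im =
        Real.pi * (D.lam j * t + (D.mu j).im) := by simp
    have hle : (1 + |(D.mu j).im|) / D.lam j ≤ t :=
      (Finset.single_le_sum (f := fun j => (1 + |(D.mu j).im|) / D.lam j)
        (fun i _ => div_nonneg (by positivity) (D.lam_pos i).le)
        (Finset.mem_univ j)).trans (hA.trans ht.1)
    rw [div_le_iff₀ (D.lam_pos j)] at hle
    have : 1 ≤ D.lam j * t + (D.mu j).im := by linarith [neg_abs_le (D.mu j).im]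
    rw [him]
    refine le_trans ?_ (le_abs_self _)
    nlinarith [Real.pi_gt_three]
  calc _ ≤ gammaPart F D (-x + t * Complex.I) * 1 := by rw [mul_one]; exact h1
    _ ≤ _ := mul_le_mul_of_nonneg_left h2 hpos.le

end SelbergTwist

/-! ### Multiplicativity of the coefficients and the local factor -/

namespace SelbergTwist

open LSeries in
lemma abscissa_le_of_summable {f : ℕ → ℂ} {x : ℝ} (h : ∀ s : ℂ, x < s.re → LSeriesSummable f s) :
    abscissaOfAbsConv f ≤ x :=
  abscissaOfAbsConv_le_of_forall_lt_LSeriesSummable fun y hy => h y (by simpa using hy)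

lemma abscissa_lt_of_summable {f : ℕ → ℂ} {x : ℝ} (h : ∀ s : ℂ, x < s.re → LSeriesSummable f s)
    {s : ℂ} (hs : x < s.re) : LSeries.abscissaOfAbsConv f < s.re :=
  (abscissa_le_of_summable h).trans_lt (by exact_mod_cast hs)

lemma abscissa_lt_top_of_summable {f : ℕ → ℂ} {x : ℝ}
    (h : ∀ s : ℂ, x < s.re → LSeriesSummable f s) : LSeries.abscissaOfAbsConv f < ⊤ :=
  (abscissa_le_of_summable h).trans_lt (EReal.coe_lt_top x)

/-- Logarithmic differentiation, on coefficients: if `∑ a(n) n^{-s} = exp (∑ b(n) n^{-s})`, then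
`a · log` is the Dirichlet convolution of `b · log` with `a`. -/
lemma logMul_eq_convolution {a b : ℕ → ℂ} {x : ℝ}
    (ha : ∀ s : ℂ, x < s.re → LSeriesSummable a s) (hb : ∀ s : ℂ, x < s.re → LSeriesSummable b s)
    (h : ∀ s : ℂ, x < s.re → LSeries a s = Complex.exp (LSeries b s)) {n : ℕ} (hn : n ≠ 0) :
    LSeries.logMul a n =
      ∑ d ∈ n.divisorsAntidiagonal, LSeries.logMul b d.1 * a d.2 := by
  have hla : ∀ s : ℂ, x < s.re → LSeriesSummable (LSeries.logMul a) s := fun s hs =>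
    LSeriesSummable_logMul_of_lt_re (abscissa_lt_of_summable ha hs)
  have hlb : ∀ s : ℂ, x < s.re → LSeriesSummable (LSeries.logMul b) s := fun s hs =>
    LSeriesSummable_logMul_of_lt_re (abscissa_lt_of_summable hb hs)
  have hconv : ∀ s : ℂ, x < s.re →
      LSeriesSummable (LSeries.convolution (LSeries.logMul b) a) s :=
    fun s hs => (hlb s hs).convolution (ha s hs)
  have heq : ∀ s : ℂ, x < s.re →
      LSeries (LSeries.logMul a) s = LSeries (LSeries.convolution (LSeries.logMul b) a) s := by
    intro s hs
    rw [LSeries_convolution' (hlb s hs) (ha s hs)]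
    have hA := LSeries_hasDerivAt (abscissa_lt_of_summable ha hs)
    have hB := (LSeries_hasDerivAt (abscissa_lt_of_summable hb hs)).cexp
    have hev : LSeries a =ᶠ[nhds s] fun s => Complex.exp (LSeries b s) := by
      filter_upwards [(isOpen_lt continuous_const Complex.continuous_re).mem_nhds hs] with w hw
        using h w hw
    have := hA.unique (hB.congr_of_eventuallyEq hev)
    rw [← h s hs] at this
    linear_combination -this
  have := LSeries.eq_of_LSeries_eventually_eq (abscissa_lt_top_of_summable hla)
    (abscissa_lt_top_of_summable hconv)
    ((eventually_gt_atTop x).mono fun y hy => heq y (by simpa using hy)) hn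
  rw [this, LSeries.convolution_def]

/-- A solution `a` of `a · log = (b · log) * a` with `b` supported on prime powers is
multiplicative. -/
lemma multiplicative_of_logMul {a b : ℕ → ℂ} (h1 : a 1 = 1)
    (hb : ∀ n : ℕ, ¬ IsPrimePow n → b n = 0)
    (h : ∀ n : ℕ, n ≠ 0 → LSeries.logMul a n =
      ∑ d ∈ n.divisorsAntidiagonal, LSeries.logMul b d.1 * a d.2)
    {u v : ℕ} (huv : u.Coprime v) (hu : u ≠ 0) (hv : v ≠ 0) : a (u * v) = a u * a v := by
  have h' : ∀ n : ℕ, n ≠ 0 → LSeries.logMul a n =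
      ∑ d ∈ n.divisors with IsPrimePow d, LSeries.logMul b d * a (n / d) := by
    intro n hn
    rw [h n hn, Nat.sum_divisorsAntidiagonal fun x y => LSeries.logMul b x * a y,
      Finset.sum_filter_of_ne]
    intro d _ hd
    by_contra hpp
    exact hd (by simp [LSeries.logMul, hb d hpp])
  induction hN : u * v using Nat.strong_induction_on generalizing u v with
  | _ N ih =>
    subst hN
    rcases eq_or_ne (u * v) 1 with h11 | h11
    · rw [mul_eq_one] at h11
      simp [h11.1, h11.2, h1]
    have huv0 : u * v ≠ 0 := mul_ne_zero hu hv
    have hstep : ∀ {x y : ℕ}, x.Coprime y → x ≠ 0 → y ≠ 0 → x * y = u * v →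
        ∑ d ∈ x.divisors with IsPrimePow d, LSeries.logMul b d * a (u * v / d) =
          LSeries.logMul a x * a y := by
      intro x y hxy hx hy hxyuv
      rw [h' x hx, Finset.sum_mul]
      refine Finset.sum_congr rfl fun d hd => ?_
      rw [Finset.mem_filter, Nat.mem_divisors] at hd
      obtain ⟨⟨hdx, -⟩, hpp⟩ := hd
      obtain ⟨e, rfl⟩ := hdx
      have hd0 : 0 < d := hpp.pos
      have he0 : e ≠ 0 := fun h => hx (by simp [h])
      have hq : u * v / d = e * y := by
        rw [← hxyuv, mul_assoc, Nat.mul_div_cancel_left _ hd0]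
      have hlt : e * y < u * v := by
        rw [← hxyuv, mul_assoc]
        exact lt_mul_of_one_lt_left (by positivity) hpp.one_lt
      rw [hq, Nat.mul_div_cancel_left _ hd0,
        ih _ hlt (Nat.Coprime.coprime_mul_left hxy) he0 hy rfl]
      ring
    -- a prime power that divides `u v` divides exactly one of the coprime factors
    have key := h' _ huv0
    rw [Nat.mul_divisors_filter_prime_pow huv, Finset.filter_union,
      Finset.sum_union (Nat.disjoint_divisors_filter_isPrimePow huv), hstep huv hu hv rfl,
      hstep huv.symm hv hu (mul_comm v u)] at key
    have hlog : Complex.log ((u * v : ℕ) : ℂ) = Complex.log u + Complex.log v := by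
      rw [← Complex.natCast_log, ← Complex.natCast_log, ← Complex.natCast_log, Nat.cast_mul,
        Real.log_mul (by exact_mod_cast hu) (by exact_mod_cast hv)]
      push_cast; ring
    have hlog0 : Complex.log ((u * v : ℕ) : ℂ) ≠ 0 := by
      rw [← Complex.natCast_log]
      have : 1 < u * v := by omega
      exact_mod_cast (Real.log_pos (by exact_mod_cast this)).ne'
    refine mul_left_cancel₀ hlog0 ?_
    simp only [LSeries.logMul] at key
    rw [key, hlog]; ring

/-- The restriction of `f` to the powers of `p` (including `p ^ 0 = 1`). -/
noncomputable def primePart (p : ℕ) (f : ℕ → ℂ) : ℕ → ℂ :=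
  (Set.range fun m : ℕ => p ^ m).indicator f

@[simp] lemma primePart_pow (p : ℕ) (f : ℕ → ℂ) (m : ℕ) : primePart p f (p ^ m) = f (p ^ m) :=
  Set.indicator_of_mem (Set.mem_range_self m) f

lemma primePart_of_notMem {p : ℕ} (f : ℕ → ℂ) {n : ℕ} (h : ∀ m, p ^ m ≠ n) :
    primePart p f n = 0 :=
  Set.indicator_of_notMem (by simpa using h) f

lemma primePart_one (p : ℕ) (f : ℕ → ℂ) : primePart p f 1 = f 1 := by
  simpa using primePart_pow p f 0

lemma term_primePart_pow {p : ℕ} (hp : p.Prime) (f : ℕ → ℂ) (s : ℂ) (m : ℕ) :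
    LSeries.term (primePart p f) s (p ^ m) = f (p ^ m) * (p : ℂ) ^ (-((m : ℂ) * s)) := by
  rw [LSeries.term_of_ne_zero (pow_ne_zero _ hp.ne_zero), primePart_pow, Complex.cpow_neg,
    Complex.natCast_cpow_natCast_mul, Nat.cast_pow, div_eq_mul_inv]

lemma term_primePart_of_notMem {p : ℕ} (f : ℕ → ℂ) (s : ℂ) {n : ℕ}
    (h : n ∉ Set.range fun m : ℕ => p ^ m) : LSeries.term (primePart p f) s n = 0 := by
  rw [LSeries.term_def, primePart, Set.indicator_of_notMem h]; simp

lemma LSeries_primePart {p : ℕ} (hp : p.Prime) (f : ℕ → ℂ) (s : ℂ) :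
    LSeries (primePart p f) s = ∑' m : ℕ, f (p ^ m) * (p : ℂ) ^ (-((m : ℂ) * s)) := by
  have hinj : Function.Injective fun m : ℕ => p ^ m := Nat.pow_right_injective hp.two_le
  rw [LSeries, ← hinj.tsum_eq]
  · exact tsum_congr fun m => term_primePart_pow hp f s m
  · intro n hn
    by_contra hcon
    exact hn (term_primePart_of_notMem f s hcon)

/-- A Dirichlet series supported on the powers of one prime converges as soon as its coefficients
are `O(n^x)` with `x < σ`. -/
lemma LSeriesSummable_primePart {p : ℕ} (hp : p.Prime) {f : ℕ → ℂ} {x C : ℝ}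
    (hf : ∀ n : ℕ, 1 ≤ n → ‖f n‖ ≤ C * (n : ℝ) ^ x) {s : ℂ} (hs : x < s.re) :
    LSeriesSummable (primePart p f) s := by
  have hinj : Function.Injective fun m : ℕ => p ^ m := Nat.pow_right_injective hp.two_le
  have hp0 : (0 : ℝ) < p := by exact_mod_cast hp.pos
  have hp1 : (1 : ℝ) < p := by exact_mod_cast hp.one_lt
  rw [LSeriesSummable, ← hinj.summable_iff fun n hn => term_primePart_of_notMem f s hn]
  have hr : (p : ℝ) ^ (x - s.re) < 1 := Real.rpow_lt_one_of_one_lt_of_neg hp1 (by linarith)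
  refine Summable.of_norm_bounded
    ((summable_geometric_of_lt_one (Real.rpow_nonneg hp0.le _) hr).mul_left C) fun m => ?_
  rw [Function.comp, LSeries.norm_term_eq, if_neg (pow_ne_zero _ hp.ne_zero), primePart_pow]
  have h1 := hf (p ^ m) (Nat.one_le_pow _ _ hp.pos)
  rw [Nat.cast_pow] at h1 ⊢
  rw [div_le_iff₀ (Real.rpow_pos_of_pos (pow_pos hp0 m) _)]
  refine h1.trans (le_of_eq ?_)
  rw [mul_assoc, ← Real.rpow_natCast ((p : ℝ) ^ (x - s.re)), ← Real.rpow_mul hp0.le,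
    ← Real.rpow_natCast (p : ℝ), ← Real.rpow_mul hp0.le, ← Real.rpow_mul hp0.le,
    ← Real.rpow_add hp0]
  ring_nf

lemma primePart_logMul (p : ℕ) (f : ℕ → ℂ) (n : ℕ) :
    LSeries.logMul (primePart p f) n = primePart p (LSeries.logMul f) n := by
  by_cases h : n ∈ Set.range fun m : ℕ => p ^ m
  · simp [LSeries.logMul, primePart, Set.indicator_of_mem h]
  · simp [LSeries.logMul, primePart, Set.indicator_of_notMem h]

/-- Restricting to the powers of a prime commutes with Dirichlet convolution. -/
lemma primePart_convolution {p : ℕ} (hp : p.Prime) (f g : ℕ → ℂ) (n : ℕ) :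
    ∑ d ∈ n.divisorsAntidiagonal, primePart p f d.1 * primePart p g d.2 =
      primePart p (fun n => ∑ d ∈ n.divisorsAntidiagonal, f d.1 * g d.2) n := by
  by_cases h : n ∈ Set.range fun m : ℕ => p ^ m
  · obtain ⟨m, rfl⟩ := h
    rw [primePart_pow]
    refine Finset.sum_congr rfl fun d hd => ?_
    have hd' := (Nat.mem_divisorsAntidiagonal.1 hd).1
    obtain ⟨i, -, hi⟩ := (Nat.dvd_prime_pow hp).1 (Dvd.intro _ hd')
    obtain ⟨j, -, hj⟩ := (Nat.dvd_prime_pow hp).1 (Dvd.intro_left _ hd')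
    rw [hi, hj, primePart_pow, primePart_pow]
  · rw [primePart_of_notMem _ (by simpa using h)]
    refine Finset.sum_eq_zero fun d hd => ?_
    have hd' := (Nat.mem_divisorsAntidiagonal.1 hd).1
    by_cases h1 : d.1 ∈ Set.range fun m : ℕ => p ^ m
    · by_cases h2 : d.2 ∈ Set.range fun m : ℕ => p ^ m
      · obtain ⟨i, hi⟩ := h1
        obtain ⟨j, hj⟩ := h2
        exact absurd ⟨i + j, by simp only at hi hj ⊢; rw [pow_add, hi, hj, hd']⟩ h
      · rw [primePart_of_notMem g (by simpa using h2), mul_zero]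
    · rw [primePart_of_notMem f (by simpa using h1), zero_mul]

variable {a : ℕ → ℂ} {F : ℂ → ℂ} {D : FunctionalEquationData} {p : ℕ}

/-- The converse of `logMul_eq_convolution`: the relation between coefficients is the differential
equation `E' = B' E`, and the constant of integration is determined at `+∞`. -/
lemma LSeries_eq_exp_of_logMul {e b : ℕ → ℂ} {x : ℝ}
    (he : ∀ s : ℂ, x < s.re → LSeriesSummable e s) (hb : ∀ s : ℂ, x < s.re → LSeriesSummable b s)
    (h1 : e 1 = 1) (hb1 : b 1 = 0)
    (h : ∀ n : ℕ, n ≠ 0 → LSeries.logMul e n =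
      ∑ d ∈ n.divisorsAntidiagonal, LSeries.logMul b d.1 * e d.2)
    {s : ℂ} (hs : x < s.re) : LSeries e s = Complex.exp (LSeries b s) := by
  set U : Set ℂ := {s : ℂ | x < s.re}
  have hU : IsOpen U := isOpen_lt continuous_const Complex.continuous_re
  have hUc : IsPreconnected U := (convex_halfSpace_re_gt x).isPreconnected
  set f : ℂ → ℂ := fun s => LSeries e s * Complex.exp (-LSeries b s)
  have hder : ∀ w ∈ U, HasDerivAt f 0 w := by
    intro w hw
    have hE := LSeries_hasDerivAt (abscissa_lt_of_summable he hw)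
    have hB := (LSeries_hasDerivAt (abscissa_lt_of_summable hb hw)).neg.cexp
    have hlb := LSeriesSummable_logMul_of_lt_re (abscissa_lt_of_summable hb hw)
    have hcv : LSeries (LSeries.logMul e) w = LSeries (LSeries.logMul b) w * LSeries e w := by
      rw [← LSeries_convolution' hlb (he w hw), LSeries.convolution_def]
      exact LSeries_congr (fun {n} hn => h n hn) w
    refine (hE.mul hB).congr_deriv ?_
    rw [hcv]; ring
  have hconst : ∀ w ∈ U, f w = f s := fun w hw =>
    hU.is_const_of_deriv_eq_zero hUc
      (fun w hw => (hder w hw).differentiableAt.differentiableWithinAt)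
      (fun w hw => (hder w hw).deriv) hw hs
  have hlim : Tendsto (fun y : ℝ => f y) atTop (nhds 1) := by
    have h2 := (LSeries.tendsto_atTop (abscissa_lt_top_of_summable he)).mul
      ((LSeries.tendsto_atTop (abscissa_lt_top_of_summable hb)).neg.cexp)
    simpa [h1, hb1] using h2
  have hlim' : Tendsto (fun y : ℝ => f y) atTop (nhds (f s)) := by
    refine tendsto_const_nhds.congr' ?_
    filter_upwards [eventually_gt_atTop x] with y hy
    exact (hconst y (by simpa [U] using hy)).symm
  have hfs : LSeries e s * Complex.exp (-LSeries b s) = 1 := tendsto_nhds_unique hlim' hlim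
  rw [Complex.exp_neg] at hfs
  exact eq_of_mul_inv_eq_one hfs

lemma IsSelberg.coeff_one (hF : IsSelberg a F D) : a 1 = 1 := by
  obtain ⟨b, -, -, -, hsupp, -, h⟩ := hF.euler
  have h1 := LSeries.tendsto_atTop
    (abscissa_lt_top_of_summable fun s hs => (hF.dirichlet s hs).1)
  have h2 := (LSeries.tendsto_atTop
    (abscissa_lt_top_of_summable fun s hs => (h s hs).1)).cexp
  rw [hsupp 1 not_isPrimePow_one, Complex.exp_zero] at h2
  refine tendsto_nhds_unique h1 (h2.congr' ?_)
  filter_upwards [eventually_gt_atTop 1] with y hy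
  have hy' : 1 < (y : ℂ).re := by simpa using hy
  rw [← (h y hy').2, (hF.dirichlet y hy').2]

lemma IsSelberg.exists_logMul (hF : IsSelberg a F D) :
    ∃ (b : ℕ → ℂ) (θ C : ℝ), θ < 1 / 2 ∧ (∀ n : ℕ, ¬ IsPrimePow n → b n = 0) ∧
      (∀ n : ℕ, 1 ≤ n → ‖b n‖ ≤ C * (n : ℝ) ^ θ) ∧
      ∀ n : ℕ, n ≠ 0 → LSeries.logMul a n =
        ∑ d ∈ n.divisorsAntidiagonal, LSeries.logMul b d.1 * a d.2 := by
  obtain ⟨b, θ, C, hθ, hsupp, hbd, h⟩ := hF.euler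
  refine ⟨b, θ, C, hθ, hsupp, hbd, fun n hn => ?_⟩
  exact logMul_eq_convolution (x := 1) (fun s hs => (hF.dirichlet s hs).1)
    (fun s hs => (h s hs).1)
    (fun s hs => by rw [← (hF.dirichlet s hs).2, (h s hs).2]) hn

lemma IsSelberg.multiplicative (hF : IsSelberg a F D) {u v : ℕ} (huv : u.Coprime v) (hu : u ≠ 0)
    (hv : v ≠ 0) : a (u * v) = a u * a v := by
  obtain ⟨b, -, -, -, hsupp, -, h⟩ := hF.exists_logMul
  exact multiplicative_of_logMul hF.coeff_one hsupp h huv hu hv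

lemma localFactor_eq_LSeries (hp : p.Prime) (s : ℂ) :
    localFactor a p s = LSeries (primePart p a) s :=
  (LSeries_primePart hp a s).symm

lemma IsSelberg.summable_primePart (hF : IsSelberg a F D) (hp : p.Prime) {s : ℂ}
    (hs : 0 < s.re) : LSeriesSummable (primePart p a) s := by
  obtain ⟨C, hC⟩ := hF.ramanujan (s.re / 2) (by linarith)
  exact LSeriesSummable_primePart hp hC (by linarith)

lemma IsSelberg.differentiableOn_localFactor (hF : IsSelberg a F D) (hp : p.Prime) :
    DifferentiableOn ℂ (localFactor a p) {s : ℂ | 0 < s.re} := by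
  intro s hs
  have h := LSeries_hasDerivAt
    (abscissa_lt_of_summable (fun s hs => hF.summable_primePart hp hs) hs)
  rw [show localFactor a p = LSeries (primePart p a) from funext (localFactor_eq_LSeries hp)]
  exact h.differentiableAt.differentiableWithinAt

/-- Here the hypothesis `θ < 1 / 2` enters: the local factor has a logarithm, hence no zeros, on
some half plane that contains the closed half plane `σ ≥ 1 / 2`. -/
lemma IsSelberg.exists_log_localFactor (hF : IsSelberg a F D) (hp : p.Prime) :
    ∃ (b : ℕ → ℂ) (θ : ℝ), 0 ≤ θ ∧ θ < 1 / 2 ∧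
      (∀ s : ℂ, θ < s.re → LSeriesSummable (primePart p b) s) ∧
      (∀ s : ℂ, θ < s.re → localFactor a p s = Complex.exp (LSeries (primePart p b) s)) := by
  obtain ⟨b, θ, C, hθ, hsupp, hbd, h⟩ := hF.exists_logMul
  have hsum : ∀ s : ℂ, max θ 0 < s.re → LSeriesSummable (primePart p b) s := fun s hs =>
    LSeriesSummable_primePart hp hbd ((le_max_left _ _).trans_lt hs)
  refine ⟨b, max θ 0, le_max_right _ _, max_lt hθ (by norm_num), hsum, fun s hs => ?_⟩
  rw [localFactor_eq_LSeries hp]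
  refine LSeries_eq_exp_of_logMul
    (fun s hs => hF.summable_primePart hp ((le_max_right _ _).trans_lt hs)) hsum
    (by rw [primePart_one, hF.coeff_one])
    (by rw [primePart_one, hsupp 1 not_isPrimePow_one]) (fun n hn => ?_) hs
  simp only [primePart_logMul]
  rw [primePart_convolution hp]
  by_cases hmem : n ∈ Set.range fun m : ℕ => p ^ m
  · rw [primePart, primePart, Set.indicator_of_mem hmem, Set.indicator_of_mem hmem, h n hn]
  · rw [primePart, primePart, Set.indicator_of_notMem hmem, Set.indicator_of_notMem hmem]

lemma characterTwist_one_apply (hp : p.Prime) (a : ℕ → ℂ) (n : ℕ) :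
    characterTwist a (1 : DirichletCharacter ℂ p) n = if p ∣ n then 0 else a n := by
  have hu : IsUnit (n : ZMod p) ↔ ¬ p ∣ n := by
    rw [ZMod.isUnit_iff_coprime, Nat.coprime_comm, hp.coprime_iff_not_dvd]
  unfold characterTwist
  split_ifs with h
  · rw [MulChar.map_nonunit _ (by rw [hu]; exact not_not.2 h), mul_zero]
  · rw [MulChar.one_apply (hu.2 h), mul_one]

lemma IsSelberg.summable_of_norm_le (hF : IsSelberg a F D) {c : ℕ → ℂ} {K : ℝ}
    (hc : ∀ n, ‖c n‖ ≤ K * ‖a n‖) {s : ℂ} (hs : 1 < s.re) : LSeriesSummable c s := by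
  refine Summable.of_norm_bounded (((hF.dirichlet s hs).1.norm).mul_left K) fun n => ?_
  rw [LSeries.norm_term_eq, LSeries.norm_term_eq]
  split_ifs with h
  · simp
  · rw [mul_div_assoc']
    gcongr
    exact hc n

lemma norm_characterTwist_le (a : ℕ → ℂ) {q : ℕ} (χ : DirichletCharacter ℂ q) (n : ℕ) :
    ‖characterTwist a χ n‖ ≤ ‖a n‖ := by
  rw [characterTwist, norm_mul]
  exact mul_le_of_le_one_right (norm_nonneg _) (χ.norm_le_one _)

/-- Splitting the `p`-th factor off the Euler product: `F(s) = F_p(s) F(s, χ₀)`. -/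
lemma IsSelberg.eq_localFactor_mul (hF : IsSelberg a F D) (hp : p.Prime) {s : ℂ} (hs : 1 < s.re) :
    F s = localFactor a p s * LSeries (characterTwist a (1 : DirichletCharacter ℂ p)) s := by
  have hsum : LSeriesSummable (characterTwist a (1 : DirichletCharacter ℂ p)) s :=
    hF.summable_of_norm_le (K := 1) (fun n => by
      rw [one_mul]; exact norm_characterTwist_le a _ n) hs
  rw [(hF.dirichlet s hs).2, localFactor_eq_LSeries hp,
    ← LSeries_convolution' (hF.summable_primePart hp (by linarith)) hsum, LSeries.convolution_def]
  refine LSeries_congr (fun {n} hn => ?_) s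
  have hpn : p ^ n.factorization p * (n / p ^ n.factorization p) = n :=
    Nat.ordProj_mul_ordCompl_eq_self n p
  have hcop : ¬ p ∣ n / p ^ n.factorization p := Nat.not_dvd_ordCompl hp hn
  have hne : n / p ^ n.factorization p ≠ 0 := fun h => hcop (by simp [h])
  rw [Finset.sum_eq_single (p ^ n.factorization p, n / p ^ n.factorization p)]
  · rw [primePart_pow, characterTwist_one_apply hp, if_neg hcop, ← hF.multiplicative
      (Nat.Coprime.pow_left _ ((hp.coprime_iff_not_dvd).2 hcop)) (pow_ne_zero _ hp.ne_zero) hne,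
      hpn]
  · rintro ⟨x, y⟩ hxy hne'
    have hxyn := (Nat.mem_divisorsAntidiagonal.1 hxy).1
    simp only at hxyn ⊢
    by_cases hx : x ∈ Set.range fun m : ℕ => p ^ m
    · obtain ⟨m, rfl⟩ := hx
      by_cases hy : p ∣ y
      · rw [characterTwist_one_apply hp, if_pos hy, mul_zero]
      · exfalso
        have hy0 : y ≠ 0 := fun h => hy (by simp [h])
        have hm : n.factorization p = m := by
          rw [← hxyn, Nat.factorization_mul (pow_ne_zero _ hp.ne_zero) hy0, Finsupp.add_apply,
            hp.factorization_pow, Finsupp.single_eq_same, Nat.factorization_eq_zero_of_not_dvd hy,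
            add_zero]
        refine hne' ?_
        rw [hm]
        simp only [Prod.mk.injEq, true_and]
        rw [← hxyn, Nat.mul_div_cancel_left _ (pow_pos hp.pos _)]
    · rw [primePart_of_notMem _ (by simpa using hx), zero_mul]
  · intro hcon
    exact absurd (Nat.mem_divisorsAntidiagonal.2 ⟨hpn, hn⟩) hcon

end SelbergTwist

/-! ### Additive and multiplicative twists -/

namespace SelbergTwist

lemma MemM.zero (d h : ℝ) : MemM d h 0 :=
  ⟨fun s => analyticAt_const.meromorphicAt, by fun_prop,
    fun A B _ => ⟨0, 0, by simp⟩⟩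

lemma MemM.const_mul {d h : ℝ} {f : ℂ → ℂ} (hf : MemM d h f) (k : ℂ) :
    MemM d h (fun s => k * f s) := by
  refine ⟨fun s => (MeromorphicAt.const k s).mul (hf.meromorphic s), hf.holomorphic.const_mul k,
    fun A B hAB => ?_⟩
  obtain ⟨C, K, h⟩ := hf.growth A B hAB
  refine ⟨C, ‖k‖ * K, ?_⟩
  filter_upwards [h] with σ hσ t ht
  rw [norm_mul, mul_assoc]
  exact mul_le_mul_of_nonneg_left (hσ t ht) (norm_nonneg _)

lemma MemM.add {d h : ℝ} (hh : 0 < h) {f g : ℂ → ℂ} (hf : MemM d h f) (hg : MemM d h g) :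
    MemM d h (fun s => f s + g s) := by
  refine ⟨fun s => (hf.meromorphic s).add (hg.meromorphic s), hf.holomorphic.add hg.holomorphic,
    fun A B hAB => ?_⟩
  obtain ⟨C₁, K₁, h₁⟩ := hf.growth A B hAB
  obtain ⟨C₂, K₂, h₂⟩ := hg.growth A B hAB
  refine ⟨max C₁ C₂, |K₁| + |K₂|, ?_⟩
  filter_upwards [h₁, h₂, eventually_le_atBot (-1)] with σ h₁ h₂ hσ t ht
  have h1 : 1 ≤ |σ| := by rw [abs_of_neg (by linarith)]; linarith
  have hpi := Real.pi_pos
  have hX : 0 ≤ |σ| ^ (d * |σ|) * (h / (2 * Real.pi * Real.exp 1) ^ d) ^ |σ| := by positivity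
  set X := |σ| ^ (d * |σ|) * (h / (2 * Real.pi * Real.exp 1) ^ d) ^ |σ|
  have key : ∀ K C : ℝ, C ≤ max C₁ C₂ →
      K * (X * |σ| ^ C) ≤ |K| * (X * |σ| ^ max C₁ C₂) := by
    intro K C hC
    have : |σ| ^ C ≤ |σ| ^ max C₁ C₂ := Real.rpow_le_rpow_of_exponent_le h1 hC
    calc K * (X * |σ| ^ C) ≤ |K| * (X * |σ| ^ C) := by
          gcongr; exact le_abs_self K
      _ ≤ _ := by gcongr
  rw [add_mul]
  exact (norm_add_le _ _).trans (add_le_add ((h₁ t ht).trans (key _ _ (le_max_left _ _)))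
    ((h₂ t ht).trans (key _ _ (le_max_right _ _))))

lemma SeriesMemM.sum {d h : ℝ} (hh : 0 < h) {ι : Type*} (S : Finset ι) (k : ι → ℂ)
    (c : ι → ℕ → ℂ) (hs : ∀ i ∈ S, ∀ s : ℂ, 1 < s.re → LSeriesSummable (c i) s)
    (hc : ∀ i ∈ S, SeriesMemM d h (c i)) :
    SeriesMemM d h (fun n => ∑ i ∈ S, k i * c i n) := by
  classical
  have hmem : ∀ f : ι → ℂ → ℂ, (∀ i ∈ S, MemM d h (f i)) →
      MemM d h (fun s => ∑ i ∈ S, k i * f i s) := by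
    intro f
    clear hs hc
    induction S using Finset.induction_on with
    | empty => intro; simpa using! MemM.zero d h
    | insert i S hi ih =>
      intro hf
      simp only [Finset.sum_insert hi]
      exact MemM.add hh ((hf i (Finset.mem_insert_self i S)).const_mul (k i))
        (ih fun j hj => hf j (Finset.mem_insert_of_mem hj))
  choose! f hf hfe using hc
  refine ⟨_, hmem f hf, fun s hs1 => ?_⟩
  have : (fun n => ∑ i ∈ S, k i * c i n) = ∑ i ∈ S, k i • c i := by
    ext n; simp [Finset.sum_apply]
  rw [this, LSeries_sum fun i hi => (hs i hi s hs1).smul (k i)]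
  exact Finset.sum_congr rfl fun i hi => by rw [LSeries_smul, hfe i hi s hs1]

variable {p : ℕ} [Fact p.Prime]

lemma linearTwist_eq (a : ℕ → ℂ) (b : ℤ) (n : ℕ) :
    linearTwist a ((b : ℝ) / (p : ℝ)) n =
      a n * ZMod.stdAddChar (-((b : ZMod p) * (n : ZMod p))) := by
  have : (-((b : ZMod p) * (n : ZMod p))) = ((-(b * n) : ℤ) : ZMod p) := by push_cast; ring
  rw [linearTwist, this, ZMod.stdAddChar_coe]
  congr 2
  push_cast; ring

lemma norm_linearTwist (a : ℕ → ℂ) (α : ℝ) (n : ℕ) : ‖linearTwist a α n‖ = ‖a n‖ := by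
  rw [linearTwist, norm_mul, show (2 * Real.pi * Complex.I * (-((n : ℂ) * (α : ℂ))) : ℂ) =
    ((2 * Real.pi * (-(n * α)) : ℝ) : ℂ) * Complex.I by push_cast; ring,
    Complex.norm_exp_ofReal_mul_I, mul_one]

/-- The coefficients `a(n)(p - 1 - p χ₀(n))` of `(p - 1) F(s) - p F(s, χ₀)`, the sum of all the
linear twists of `F` by nonzero residues modulo `p`. -/
noncomputable def residualTwist (a : ℕ → ℂ) (p n : ℕ) : ℂ :=
  a n * ((p : ℂ) - 1 - p * (1 : DirichletCharacter ℂ p) (n : ZMod p))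

lemma sum_stdAddChar_ne_zero (m : ZMod p) :
    ∑ u ∈ Finset.univ.erase (0 : ZMod p), ZMod.stdAddChar (-(u * m)) =
      (p : ℂ) - 1 - p * (1 : DirichletCharacter ℂ p) m := by
  classical
  have h := AddChar.sum_mulShift (-m) (ZMod.isPrimitive_stdAddChar p)
  rw [Finset.sum_erase_eq_sub (Finset.mem_univ _)]
  simp only [zero_mul, neg_zero, AddChar.map_zero_eq_one]
  simp only [mul_neg] at h
  rw [h]
  by_cases hm : m = 0
  · subst hm
    rw [MulChar.map_nonunit _ (by simp)]
    simp [ZMod.card]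
  · rw [MulChar.one_apply (isUnit_iff_ne_zero.2 hm), if_neg (neg_ne_zero.2 hm)]
    simp

lemma residualTwist_eq_sum (a : ℕ → ℂ) (n : ℕ) :
    residualTwist a p n = ∑ u ∈ Finset.univ.erase (0 : ZMod p),
      1 * linearTwist a (((u.val : ℤ) : ℝ) / (p : ℝ)) n := by
  rw [residualTwist, ← sum_stdAddChar_ne_zero, Finset.mul_sum]
  refine Finset.sum_congr rfl fun u _ => ?_
  rw [one_mul, linearTwist_eq]
  simp

/-- Multiplicative twists in terms of additive ones, through Gauss sums. -/
lemma characterTwist_eq_sum (a : ℕ → ℂ) {χ : DirichletCharacter ℂ p} (hχ : χ ≠ 1) (n : ℕ) :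
    characterTwist a χ n = ∑ u ∈ Finset.univ.erase (0 : ZMod p),
      (χ⁻¹ u / gaussSum χ⁻¹ (ZMod.stdAddChar (N := p))⁻¹) *
        linearTwist a (((u.val : ℤ) : ℝ) / (p : ℝ)) n := by
  classical
  have hχ' : χ⁻¹ ≠ 1 := inv_ne_one.2 hχ
  set ψ : AddChar (ZMod p) ℂ := (ZMod.stdAddChar (N := p))⁻¹ with hψ
  have hψp : ψ.IsPrimitive := by
    intro u hu
    have := ZMod.isPrimitive_stdAddChar p hu
    intro h
    refine this ?_
    ext x
    have h2 := DFunLike.congr_fun h (-x)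
    simpa [hψ, AddChar.mulShift_apply, AddChar.inv_apply] using h2
  have hG : gaussSum χ⁻¹ ψ ≠ 0 := gaussSum_ne_zero_of_nontrivial
    (by simpa [ZMod.card] using (Fact.out : p.Prime).ne_zero) hχ' hψp
  have key : χ (n : ZMod p) * gaussSum χ⁻¹ ψ =
      ∑ u : ZMod p, χ⁻¹ u * ZMod.stdAddChar (-(u * (n : ZMod p))) := by
    have hs : gaussSum χ⁻¹ (ψ.mulShift (n : ZMod p)) =
        ∑ u : ZMod p, χ⁻¹ u * ZMod.stdAddChar (-(u * (n : ZMod p))) := by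
      refine Finset.sum_congr rfl fun u _ => ?_
      simp [hψ, AddChar.mulShift_apply, AddChar.inv_apply, mul_comm]
    rw [← hs]
    by_cases hn : (n : ZMod p) = 0
    · rw [hn, AddChar.mulShift_zero, gaussSum_one_right hχ', MulChar.map_nonunit _ (by simp),
        zero_mul]
    · obtain ⟨v, hv⟩ := isUnit_iff_ne_zero.2 hn
      rw [← hv, gaussSum_mulShift_eq, inv_inv]
  have h0 : (χ⁻¹ (0 : ZMod p)) = 0 := MulChar.map_nonunit _ (by simp)
  have hterm : ∀ u : ZMod p, (χ⁻¹ u / gaussSum χ⁻¹ ψ) *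
      linearTwist a (((u.val : ℤ) : ℝ) / (p : ℝ)) n =
      a n / gaussSum χ⁻¹ ψ * (χ⁻¹ u * ZMod.stdAddChar (-(u * (n : ZMod p)))) := by
    intro u
    have hu : ((u.val : ℤ) : ZMod p) = u := by simp
    rw [linearTwist_eq, hu]
    ring
  rw [Finset.sum_erase _ (by rw [h0]; simp), Finset.sum_congr rfl fun u _ => hterm u,
    ← Finset.mul_sum, ← key, characterTwist]
  field_simp

/-- Additive twists in terms of multiplicative ones, by orthogonality of characters. The residual
twist takes the place of the principal character. -/
lemma linearTwist_eq_sum (a : ℕ → ℂ) {b : ℤ} (hb : ¬ (p : ℤ) ∣ b) :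
    ∃ k : DirichletCharacter ℂ p → ℂ, ∀ n : ℕ, linearTwist a ((b : ℝ) / (p : ℝ)) n =
      ∑ χ, k χ * (if χ = 1 then residualTwist a p n else characterTwist a χ n) := by
  classical
  have hp : p.Prime := Fact.out
  have hb' : (b : ZMod p) ≠ 0 := by rwa [Ne, ZMod.intCast_zmod_eq_zero_iff_dvd]
  have hp1 : (p : ℂ) - 1 ≠ 0 := by
    rw [sub_ne_zero]; exact_mod_cast hp.one_lt.ne'
  set ψ := ZMod.stdAddChar (N := p)
  set c : DirichletCharacter ℂ p → ℂ := fun χ => ((p : ℂ) - 1)⁻¹ *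
    ∑ m ∈ Finset.univ.erase (0 : ZMod p), χ m⁻¹ * ψ (-(m * (b : ZMod p))) with hc
  have hc1 : c 1 = -((p : ℂ) - 1)⁻¹ := by
    have h1 : ∑ m ∈ Finset.univ.erase (0 : ZMod p),
        (1 : DirichletCharacter ℂ p) m⁻¹ * ψ (-(m * (b : ZMod p))) =
        ∑ m ∈ Finset.univ.erase (0 : ZMod p), ψ (-(m * (b : ZMod p))) := by
      refine Finset.sum_congr rfl fun m hm => ?_
      rw [MulChar.one_apply (isUnit_iff_ne_zero.2 (inv_ne_zero (Finset.ne_of_mem_erase hm))),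
        one_mul]
    simp only [hc]
    rw [h1, sum_stdAddChar_ne_zero, MulChar.one_apply (isUnit_iff_ne_zero.2 hb')]
    ring
  refine ⟨fun χ => if χ = 1 then ((p : ℂ) - 1)⁻¹ else c χ, fun n => ?_⟩
  have horth : ∑ χ : DirichletCharacter ℂ p, c χ * χ (n : ZMod p) =
      if (n : ZMod p) = 0 then 0 else ψ (-((b : ZMod p) * (n : ZMod p))) := by
    split_ifs with hn
    · refine Finset.sum_eq_zero fun χ _ => ?_
      rw [hn, MulChar.map_nonunit _ (by simp), mul_zero]
    · have hsw : ∑ χ : DirichletCharacter ℂ p, c χ * χ (n : ZMod p) =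
          ((p : ℂ) - 1)⁻¹ * ∑ m ∈ Finset.univ.erase (0 : ZMod p), ψ (-(m * (b : ZMod p))) *
            ∑ χ : DirichletCharacter ℂ p, χ m⁻¹ * χ (n : ZMod p) := by
        simp only [hc, Finset.mul_sum, Finset.sum_mul]
        rw [Finset.sum_comm]
        exact Finset.sum_congr rfl fun m _ => Finset.sum_congr rfl fun χ _ => by ring
      rw [hsw, Finset.sum_eq_single (n : ZMod p)]
      · rw [DirichletCharacter.sum_char_inv_mul_char_eq ℂ (isUnit_iff_ne_zero.2 hn), if_pos rfl,
          Nat.totient_prime hp, Nat.cast_sub hp.one_le, mul_comm (b : ZMod p)]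
        push_cast
        field_simp
      · intro m hm hmn
        rw [DirichletCharacter.sum_char_inv_mul_char_eq ℂ
          (isUnit_iff_ne_zero.2 (Finset.ne_of_mem_erase hm)), if_neg hmn, mul_zero]
      · intro h
        exact absurd (Finset.mem_erase.2 ⟨hn, Finset.mem_univ _⟩) h
  rw [← Finset.add_sum_erase _ _ (Finset.mem_univ 1)] at horth ⊢
  have hrest : ∑ χ ∈ Finset.univ.erase (1 : DirichletCharacter ℂ p),
      (if χ = 1 then ((p : ℂ) - 1)⁻¹ else c χ) *
        (if χ = 1 then residualTwist a p n else characterTwist a χ n) =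
      a n * ∑ χ ∈ Finset.univ.erase (1 : DirichletCharacter ℂ p), c χ * χ (n : ZMod p) := by
    rw [Finset.mul_sum]
    refine Finset.sum_congr rfl fun χ hχ => ?_
    rw [if_neg (Finset.ne_of_mem_erase hχ), if_neg (Finset.ne_of_mem_erase hχ), characterTwist]
    ring
  rw [hrest, if_pos rfl]
  beta_reduce
  rw [if_pos rfl, linearTwist_eq, residualTwist]
  rw [hc1] at horth
  by_cases hn : (n : ZMod p) = 0
  · rw [if_pos hn] at horth
    rw [hn, MulChar.map_nonunit _ (by simp)] at horth ⊢
    rw [eq_neg_of_add_eq_zero_right horth, mul_zero, neg_zero, AddChar.map_zero_eq_one]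
    field_simp
    ring
  · rw [if_neg hn] at horth
    rw [MulChar.one_apply (isUnit_iff_ne_zero.2 hn)] at horth ⊢
    rw [← horth]
    field_simp
    ring

variable {F : ℂ → ℂ} {D : FunctionalEquationData} {a : ℕ → ℂ}

lemma norm_residualTwist_le (a : ℕ → ℂ) (n : ℕ) :
    ‖residualTwist a p n‖ ≤ (2 * p + 1) * ‖a n‖ := by
  rw [residualTwist, norm_mul, mul_comm]
  refine mul_le_mul_of_nonneg_right ?_ (norm_nonneg _)
  have h1 : ‖(p : ℂ) * (1 : DirichletCharacter ℂ p) (n : ZMod p)‖ ≤ p := by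
    rw [norm_mul, Complex.norm_natCast]
    exact mul_le_of_le_one_right (Nat.cast_nonneg p) (DirichletCharacter.norm_le_one _ _)
  have h2 : ‖(p : ℂ) - 1‖ ≤ p + 1 := by
    simpa using norm_sub_le (p : ℂ) 1
  linarith [norm_sub_le ((p : ℂ) - 1) (p * (1 : DirichletCharacter ℂ p) (n : ZMod p))]

/-- The twists by nonzero residues span the same space as the twists by nonprincipal characters
together with the residual twist. -/
lemma IsSelberg.linearTwist_mem_iff (hF : IsSelberg a F D) {d h : ℝ} (hh : 0 < h) :
    (∀ b : ℤ, ¬ (p : ℤ) ∣ b → SeriesMemM d h (linearTwist a ((b : ℝ) / (p : ℝ)))) ↔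
      (∀ χ : DirichletCharacter ℂ p, χ ≠ 1 → SeriesMemM d h (characterTwist a χ)) ∧
        SeriesMemM d h (residualTwist a p) := by
  classical
  constructor
  · intro H
    have hs : ∀ u ∈ Finset.univ.erase (0 : ZMod p), ∀ s : ℂ, 1 < s.re →
        LSeriesSummable (linearTwist a (((u.val : ℤ) : ℝ) / (p : ℝ))) s := fun u _ s hs =>
      hF.summable_of_norm_le (K := 1) (fun n => by rw [norm_linearTwist, one_mul]) hs
    have hm : ∀ u ∈ Finset.univ.erase (0 : ZMod p),
        SeriesMemM d h (linearTwist a (((u.val : ℤ) : ℝ) / (p : ℝ))) := fun u hu => by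
      refine H _ fun hdvd => Finset.ne_of_mem_erase hu ?_
      have := (ZMod.intCast_zmod_eq_zero_iff_dvd _ p).2 hdvd
      simpa using this
    refine ⟨fun χ hχ => ?_, ?_⟩
    · rw [funext (characterTwist_eq_sum a hχ)]
      exact SeriesMemM.sum hh _ _ _ hs hm
    · rw [funext (residualTwist_eq_sum a)]
      exact SeriesMemM.sum hh _ (fun _ => 1) _ hs hm
  · rintro ⟨H1, H2⟩ b hb
    obtain ⟨k, hk⟩ := linearTwist_eq_sum a hb
    rw [funext hk]
    refine SeriesMemM.sum hh Finset.univ k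
      (fun χ n => if χ = 1 then residualTwist a p n else characterTwist a χ n) ?_ ?_
    · intro χ _ s hs
      by_cases hχ : χ = 1
      · simp only [hχ, if_true]
        exact hF.summable_of_norm_le (norm_residualTwist_le a) hs
      · simp only [hχ, if_false]
        exact hF.summable_of_norm_le (K := 1) (fun n => by
          rw [one_mul]; exact norm_characterTwist_le a _ n) hs
    · intro χ _
      by_cases hχ : χ = 1
      · simpa only [hχ, if_true] using H2
      · simpa only [hχ, if_false] using H1 χ hχ

/-- For `σ > 1` the residual twist is `F(s) (p - 1 - p / F_p(s))`. -/
lemma IsSelberg.LSeries_residualTwist (hF : IsSelberg a F D) {s : ℂ} (hs : 1 < s.re) {R : ℂ}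
    (hR : localFactor a p s * R = 1) :
    LSeries (residualTwist a p) s = F s * ((p : ℂ) - 1 - p * R) := by
  have hsum : LSeriesSummable (characterTwist a (1 : DirichletCharacter ℂ p)) s :=
    hF.summable_of_norm_le (K := 1) (fun n => by
      rw [one_mul]; exact norm_characterTwist_le a _ n) hs
  have heq : residualTwist a p = ((p : ℂ) - 1) • a -
      (p : ℂ) • characterTwist a (1 : DirichletCharacter ℂ p) := by
    ext n; simp [residualTwist, characterTwist]; ring
  have hE := hF.eq_localFactor_mul (p := p) Fact.out hs
  rw [heq, LSeries_sub ((hF.dirichlet s hs).1.smul _) (hsum.smul _), LSeries_smul, LSeries_smul,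
    ← (hF.dirichlet s hs).2]
  linear_combination ((p : ℂ) * R) * hE +
    (p * LSeries (characterTwist a (1 : DirichletCharacter ℂ p)) s) * hR

end SelbergTwist

/-! ### Entire functions of polynomial growth, and the twist attached to a polynomial local factor -/

namespace SelbergTwist

/-- The growth bound in the class `M(d, h)`, written as an exponential. -/
lemma growth_bound_eq {d h C x : ℝ} (hh : 0 < h) (hx : 0 < x) :
    |(-x)| ^ (d * |(-x)|) * (h / (2 * Real.pi * Real.exp 1) ^ d) ^ |(-x)| * |(-x)| ^ C =
      Real.exp (mainTerm d h x + C * Real.log x) := by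
  have hpi := Real.pi_pos
  have hb : 0 < h / (2 * Real.pi * Real.exp 1) ^ d := by positivity
  rw [abs_neg, abs_of_pos hx, Real.rpow_def_of_pos hx, Real.rpow_def_of_pos hb,
    Real.rpow_def_of_pos hx, ← Real.exp_add, ← Real.exp_add, mainTerm]
  ring_nf

lemma MemM.growth_exp {d h : ℝ} (hh : 0 < h) {f : ℂ → ℂ} (hf : MemM d h f) {A B : ℝ}
    (hAB : A < B) : ∃ C K : ℝ, ∀ᶠ x : ℝ in atTop, ∀ t ∈ Set.Icc A B,
      ‖f (-x + t * Complex.I)‖ ≤ K * Real.exp (mainTerm d h x + C * Real.log x) := by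
  obtain ⟨C, K, h⟩ := hf.growth A B hAB
  refine ⟨C, K, ?_⟩
  filter_upwards [tendsto_neg_atTop_atBot.eventually h, eventually_gt_atTop 0] with x hx hx0 t ht
  have := hx t ht
  rw [growth_bound_eq hh hx0] at this
  simpa using this

lemma mainTerm_sub {d h q x : ℝ} (hh : 0 < h) (hq : 0 < q) :
    mainTerm d h x - mainTerm d q x = Real.log (h / q) * x := by
  have hpi := Real.pi_pos
  rw [mainTerm, mainTerm, Real.log_div hh.ne' (by positivity), Real.log_div hq.ne' (by positivity),
    Real.log_div hh.ne' hq.ne']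
  ring

variable {a : ℕ → ℂ} {F : ℂ → ℂ} {D : FunctionalEquationData} {p : ℕ}

/-- If `1 / F_p` is a polynomial in `p^{-s}` whose degree fits the bound `h`, then the
functional equation puts the residual twist into `M(d, h)`. -/
lemma IsSelberg.residualTwist_mem (hF : IsSelberg a F D) (hp : p.Prime) {h : ℝ} (hh : 0 < h)
    {k : ℕ} {α : Fin k → ℂ}
    (hα : ∀ s : ℂ, 0 < s.re → localFactor a p s = ∏ j, (1 - α j * (p : ℂ) ^ (-s))⁻¹)
    (hα1 : ∀ j, ‖α j‖ ≤ 1)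
    (hk : (k : ℤ) ≤ ⌊Real.log (h / D.conductor) / Real.log (p : ℝ)⌋) :
    SeriesMemM D.degree h (residualTwist a p) := by
  have : Fact p.Prime := ⟨hp⟩
  have hp0 : (0 : ℝ) < p := by exact_mod_cast hp.pos
  have hp1 : (1 : ℝ) < p := by exact_mod_cast hp.one_lt
  have hp0' : (p : ℂ) ≠ 0 := by exact_mod_cast hp.ne_zero
  have hlogp : 0 < Real.log p := Real.log_pos hp1
  set f : ℂ → ℂ := fun s => F s * ((p : ℂ) - 1 - p * ∏ j, (1 - α j * (p : ℂ) ^ (-s)))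
  have hd2 : Differentiable ℂ fun s : ℂ => (p : ℂ) - 1 - p * ∏ j, (1 - α j * (p : ℂ) ^ (-s)) := by
    have : ∀ j, Differentiable ℂ fun s : ℂ => (1 - α j * (p : ℂ) ^ (-s)) := fun j =>
      (differentiable_const _).sub ((differentiable_const _).mul
        (differentiable_neg.const_cpow (Or.inl hp0')))
    exact (differentiable_const _).sub ((differentiable_const _).mul
      (Differentiable.fun_finsetProd fun j _ => this j))
  refine ⟨f, ⟨fun s => (hF.meromorphicAt s).mul (hd2.analyticAt s).meromorphicAt, fun s hs => ?_,
    fun A B hAB => ?_⟩, fun s hs => ?_⟩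
  · refine ((hF.differentiableAt ?_).mul (hd2 s)).differentiableWithinAt
    rintro rfl; norm_num at hs
  · obtain ⟨C, hC⟩ := hF.norm_le A B
    refine ⟨C, (p + 1) + p * 2 ^ k, ?_⟩
    have hat : ∀ᶠ x : ℝ in atTop, ∀ t ∈ Set.Icc A B, ‖f (-x + t * Complex.I)‖ ≤
        ((p + 1) + p * 2 ^ k) * Real.exp (mainTerm D.degree h x + C * Real.log x) := by
      filter_upwards [hC, eventually_ge_atTop 0] with x hx hx0 t ht
      have hE : (1 : ℝ) ≤ Real.exp (k * (Real.log p * x)) := Real.one_le_exp (by positivity)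
      have hnp : ‖(p : ℂ) ^ (-(-x + t * Complex.I : ℂ))‖ = Real.exp (Real.log p * x) := by
        rw [Complex.norm_natCast_cpow_of_pos hp.pos, Real.rpow_def_of_pos hp0]; simp
      have hprod : ‖∏ j, (1 - α j * (p : ℂ) ^ (-(-x + t * Complex.I : ℂ)))‖ ≤
          2 ^ k * Real.exp (k * (Real.log p * x)) := by
        rw [norm_prod]
        calc _ ≤ ∏ _j : Fin k, 2 * Real.exp (Real.log p * x) := by
              refine Finset.prod_le_prod (fun _ _ => norm_nonneg _) fun j _ => ?_
              refine (norm_sub_le _ _).trans ?_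
              rw [norm_one, norm_mul, hnp]
              have h1 : (1 : ℝ) ≤ Real.exp (Real.log p * x) := Real.one_le_exp (by positivity)
              have h2 := mul_le_mul_of_nonneg_right (hα1 j) (Real.exp_pos (Real.log p * x)).le
              linarith
          _ = _ := by
              rw [Finset.prod_const, Finset.card_univ, Fintype.card_fin, mul_pow, ← Real.exp_nat_mul]
      have h2 : ‖(p : ℂ) - 1 - p * ∏ j, (1 - α j * (p : ℂ) ^ (-(-x + t * Complex.I : ℂ)))‖ ≤
          ((p + 1) + p * 2 ^ k) * Real.exp (k * (Real.log p * x)) := by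
        refine (norm_sub_le _ _).trans ?_
        rw [norm_mul, Complex.norm_natCast]
        have h3 : ‖(p : ℂ) - 1‖ ≤ p + 1 := by simpa using norm_sub_le (p : ℂ) 1
        have h4 := mul_le_mul_of_nonneg_left hprod hp0.le
        have h5 : ((p : ℝ) + 1) * 1 ≤ (p + 1) * Real.exp (k * (Real.log p * x)) := by gcongr
        linarith
      have hexp : mainTerm D.degree D.conductor x + k * (Real.log p * x) ≤
          mainTerm D.degree h x := by
        have hsub := mainTerm_sub (d := D.degree) (x := x) hh D.conductor_pos
        have hk' : (k : ℝ) * Real.log p ≤ Real.log (h / D.conductor) := by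
          rw [← le_div_iff₀ hlogp]
          exact_mod_cast Int.le_floor.1 hk
        nlinarith [mul_le_mul_of_nonneg_right hk' hx0]
      calc ‖f (-x + t * Complex.I)‖
          ≤ Real.exp (mainTerm D.degree D.conductor x + C * Real.log x) *
            (((p + 1) + p * 2 ^ k) * Real.exp (k * (Real.log p * x))) := by
            rw [norm_mul]
            exact mul_le_mul (hx t ht) h2 (norm_nonneg _) (Real.exp_pos _).le
        _ = ((p + 1) + p * 2 ^ k) * Real.exp (mainTerm D.degree D.conductor x +
              k * (Real.log p * x) + C * Real.log x) := by
            rw [mul_left_comm, ← Real.exp_add]; ring_nf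
        _ ≤ _ := by gcongr
    filter_upwards [tendsto_neg_atBot_atTop.eventually hat, eventually_lt_atBot 0]
      with σ hσ hσ0 t ht
    have h1 := hσ t ht
    rw [← growth_bound_eq hh (by linarith : 0 < -σ), neg_neg] at h1
    simpa using h1
  · refine (hF.LSeries_residualTwist hs ?_).symm
    rw [hα s (by linarith), ← Finset.prod_mul_distrib]
    refine Finset.prod_eq_one fun j _ => inv_mul_cancel₀ fun h0 => ?_
    have h1 : ‖α j * (p : ℂ) ^ (-s)‖ = 1 := by
      rw [← sub_eq_zero.1 h0, norm_one]
    have h2 : ‖(p : ℂ) ^ (-s)‖ < 1 := by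
      rw [Complex.norm_natCast_cpow_of_pos hp.pos]
      exact Real.rpow_lt_one_of_one_lt_of_neg hp1 (by simp; linarith)
    rw [norm_mul] at h1
    nlinarith [hα1 j, norm_nonneg (α j), norm_nonneg ((p : ℂ) ^ (-s))]

/-- Cauchy's estimates: Taylor coefficients above the order of polynomial growth vanish. -/
lemma iteratedDeriv_eq_zero_of_growth {P : ℂ → ℂ} (hP : Differentiable ℂ P) {η : ℝ}
    (hg : ∀ᶠ r : ℝ in atTop, ∀ z : ℂ, ‖z‖ = r → ‖P z‖ ≤ r ^ η) {n : ℕ} (hn : η < n) :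
    iteratedDeriv n P 0 = 0 := by
  have hlim : Tendsto (fun r : ℝ => (n.factorial : ℝ) * r ^ (-((n : ℝ) - η))) atTop (nhds 0) := by
    simpa using (tendsto_rpow_neg_atTop (by linarith : 0 < (n : ℝ) - η)).const_mul
      (n.factorial : ℝ)
  refine norm_le_zero_iff.1 (ge_of_tendsto hlim ?_)
  filter_upwards [hg, eventually_gt_atTop 0] with r hr hr0
  have := Complex.norm_iteratedDeriv_le_of_forall_mem_sphere_norm_le n hr0
    (hP.diffContOnCl (s := Metric.ball 0 r)) (C := r ^ η)
    (fun z hz => hr z (by simpa using hz))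
  refine this.trans (le_of_eq ?_)
  rw [neg_sub, Real.rpow_sub hr0, Real.rpow_natCast, mul_div_assoc]

/-- An entire function of polynomial growth, normalised by `P(0) = 1`, is a product of linear
factors, with at most as many factors as the order of growth. -/
lemma exists_factorization {P : ℂ → ℂ} (hP : Differentiable ℂ P) (h0 : P 0 = 1) {κ : ℝ}
    (hg : ∀ η : ℝ, κ < η → ∀ᶠ r : ℝ in atTop, ∀ z : ℂ, ‖z‖ = r → ‖P z‖ ≤ r ^ η) :
    ∃ (k : ℕ) (α : Fin k → ℂ), (k : ℝ) ≤ κ ∧ (∀ j, α j ≠ 0 ∧ P (α j)⁻¹ = 0) ∧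
      ∀ z, P z = ∏ j, (1 - α j * z) := by
  have hzero : ∀ n : ℕ, κ < n → iteratedDeriv n P 0 = 0 := fun n hn => by
    obtain ⟨η, h1, h2⟩ := exists_between hn
    exact iteratedDeriv_eq_zero_of_growth hP (hg η h1) h2
  have hκ : 0 ≤ κ := by
    by_contra! hcon
    have := hzero 0 (by simpa using hcon)
    simp [h0] at this
  set N := ⌊κ⌋₊
  set q : Polynomial ℂ := ∑ n ∈ Finset.range (N + 1),
    Polynomial.monomial n ((n.factorial : ℂ)⁻¹ * iteratedDeriv n P 0)
  have hq : ∀ z, P z = q.eval z := by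
    intro z
    rw [← Complex.taylorSeries_eq_of_entire' 0 z hP, tsum_eq_sum (s := Finset.range (N + 1))]
    · simp only [q, Polynomial.eval_finsetSum, Polynomial.eval_monomial, sub_zero]
    · intro n hn
      rw [hzero n, mul_zero, zero_mul]
      have : N < n := by simpa using hn
      exact (Nat.floor_lt hκ).1 this
  have hdeg : q.natDegree ≤ N := by
    refine Polynomial.natDegree_sum_le_of_forall_le _ _ fun n hn => ?_
    exact (Polynomial.natDegree_monomial_le _).trans (by simpa [Nat.lt_succ_iff] using hn)
  have hq0 : q.eval 0 = 1 := by rw [← hq, h0]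
  have hqne : q ≠ 0 := by rintro h; simp [h] at hq0
  obtain ⟨l, hl⟩ : ∃ l : List ℂ, (l : Multiset ℂ) = q.roots := ⟨q.roots.toList, by simp⟩
  have hmem : ∀ r ∈ l, r ≠ 0 ∧ P r = 0 := by
    intro r hr
    have : r ∈ q.roots := by rw [← hl]; exact hr
    have hr0 := (Polynomial.mem_roots hqne).1 this
    refine ⟨?_, by rw [hq]; exact hr0⟩
    rintro rfl
    rw [Polynomial.IsRoot, hq0] at hr0
    exact one_ne_zero hr0
  have hfac : ∀ z, q.eval z = q.leadingCoeff * (l.map fun r => z - r).prod := by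
    intro z
    have := (IsAlgClosed.splits q).eq_prod_roots
    conv_lhs => rw [this]
    rw [← hl]
    simp [Polynomial.eval_mul, Polynomial.eval_list_prod, Function.comp_def]
  have hprod : ∀ z, P z = (l.map fun r => 1 - r⁻¹ * z).prod := by
    intro z
    have h1 := hfac 0
    have h2 : (l.map fun r => z - r).prod =
        (l.map fun r => 1 - r⁻¹ * z).prod * (l.map fun r => 0 - r).prod := by
      rw [← List.prod_map_mul]
      refine congrArg List.prod (List.map_congr_left fun r hr => ?_)
      have := (hmem r hr).1
      field_simp; ring
    rw [hq, hfac, h2, mul_left_comm, ← h1, hq0, mul_one]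
  refine ⟨l.length, fun j => (l.get j)⁻¹, ?_, fun j => ?_, fun z => ?_⟩
  · have : l.length = q.roots.card := by rw [← hl]; simp
    have h1 : l.length ≤ N := this ▸ (Polynomial.card_roots' q).trans hdeg
    exact (Nat.cast_le.2 h1).trans (Nat.floor_le hκ)
  · have := hmem _ (List.get_mem l j)
    rw [inv_inv]
    exact ⟨inv_ne_zero this.1, this.2⟩
  · rw [hprod, ← Fin.prod_univ_fun_getElem]
    rfl

end SelbergTwist

/-! ### Vertical progressions of zeros, and continuation of the local factor -/

namespace SelbergTwist

variable {a : ℕ → ℂ} {F : ℂ → ℂ} {D : FunctionalEquationData} {p : ℕ}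

/-- `F` has finitely many zeros in `σ > σ₀`, `|t| ≤ T`. (Otherwise the `ncard` in `zeroCount`
would be zero.) -/
lemma IsSelberg.finite_zeros (hF : IsSelberg a F D) (σ T : ℝ) :
    {ρ : ℂ | F ρ = 0 ∧ σ < ρ.re ∧ |ρ.im| ≤ T}.Finite := by
  obtain ⟨m, G, hG, -, hGF⟩ := hF.continuation
  have hK : IsCompact (Set.Icc σ 1 ×ℂ Set.Icc (-T) T) := isCompact_Icc.reProdIm isCompact_Icc
  have hfin : ({ρ : ℂ | G ρ = 0} ∩ (Set.Icc σ 1 ×ℂ Set.Icc (-T) T)).Finite := by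
    by_contra hinf
    obtain ⟨z, -, hz⟩ :=
      Set.Infinite.exists_accPt_of_subset_isCompact hinf hK Set.inter_subset_right
    have hfreq : ∃ᶠ w in nhdsWithin z {z}ᶜ, G w = 0 :=
      (accPt_iff_frequently_nhdsNE.1 hz).mono fun w hw => hw.1
    have hzero := (hG.differentiableOn (s := Set.univ)).analyticOnNhd isOpen_univ
      |>.eqOn_zero_of_preconnected_of_frequently_eq_zero isPreconnected_univ
        (Set.mem_univ z) hfreq (Set.mem_univ 2)
    rw [hGF 2 (by norm_num)] at hzero
    have h2 := hF.ne_zero (s := 2) (by norm_num)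
    norm_num at hzero
    exact h2 hzero
  refine (hfin.union (Set.finite_singleton 1)).subset ?_
  rintro ρ ⟨h0, h1, h2⟩
  by_cases hρ : ρ = 1
  · exact Or.inr hρ
  · refine Or.inl ⟨?_, ?_⟩
    · simp only [Set.mem_ofPred_eq]
      rw [hGF ρ hρ, h0, mul_zero]
    · rw [Complex.mem_reProdIm]
      refine ⟨⟨h1.le, ?_⟩, abs_le.1 h2⟩
      by_contra! hcon
      exact hF.ne_zero hcon h0

/-- High in the upper half plane zeros are reflected in the critical line. -/
lemma IsSelberg.reflected_zero (hF : IsSelberg a F D) :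
    ∃ H : ℝ, 0 ≤ H ∧ ∀ s : ℂ, H < s.im → F s = 0 → F (1 - (starRingEnd ℂ) s) = 0 := by
  have hnn : ∀ j, 0 ≤ |(D.mu j).im| / D.lam j :=
    fun j => div_nonneg (abs_nonneg _) (D.lam_pos j).le
  refine ⟨∑ j, |(D.mu j).im| / D.lam j, Finset.sum_nonneg fun j _ => hnn j, fun s hs h0 => ?_⟩
  have hpos : 0 < s.im := (Finset.sum_nonneg fun j _ => hnn j).trans_lt hs
  have hreg : ∀ w : ℂ, w.im = s.im → D.GammaRegular w := by
    intro w hw j n h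
    have him := congrArg Complex.im h
    simp [hw] at him
    have h1 : |(D.mu j).im| / D.lam j < s.im :=
      (Finset.single_le_sum (f := fun j => |(D.mu j).im| / D.lam j) (fun i _ => hnn i)
        (Finset.mem_univ j)).trans_lt hs
    rw [div_lt_iff₀ (D.lam_pos j)] at h1
    linarith [neg_abs_le (D.mu j).im]
  have hs0 : s ≠ 0 := by rintro rfl; simp at hpos
  have hs1 : s ≠ 1 := by rintro rfl; simp at hpos
  have hr := hreg _ (one_sub_conj_im s)
  have key := hF.functional_equation s hs0 hs1 (hreg s rfl) hr
  rw [FunctionalEquationData.completed, h0, mul_zero] at key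
  have homega : D.omega ≠ 0 := by
    intro h; have := D.norm_omega; rw [h] at this; simp at this
  have h2 : D.completed F (1 - (starRingEnd ℂ) s) = 0 := by
    simpa [homega] using key.symm
  rw [FunctionalEquationData.completed] at h2
  refine (mul_eq_zero.1 h2).resolve_left (mul_ne_zero ?_ ?_)
  · rw [Complex.cpow_ne_zero_iff]
    exact Or.inl (by exact_mod_cast D.Q_pos.ne')
  · exact Finset.prod_ne_zero_iff.2 fun j _ => Complex.Gamma_ne_zero fun m => hr j m

/-- The density hypothesis excludes a full vertical arithmetic progression of zeros to the left of
the critical line: its reflection would contribute `≫ T` zeros in a half plane `σ > σ₀ > 1 / 2`. -/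
lemma IsSelberg.exists_ne_zero_of_density (hF : IsSelberg a F D)
    (hN : ∀ σ : ℝ, 1 / 2 < σ →
      (fun T : ℝ => (zeroCount F σ T : ℝ)) =o[atTop] (fun T : ℝ => T))
    {ω : ℝ} (hω : 0 < ω) {ρ : ℂ} (hρ : ρ.re < 1 / 2) :
    ∃ m : ℤ, F (ρ + m * (ω * Complex.I)) ≠ 0 := by
  by_contra! hall
  obtain ⟨H, hH0, hH⟩ := hF.reflected_zero
  obtain ⟨m₀, hm₀⟩ := exists_nat_gt ((H - ρ.im) / ω)
  rw [div_lt_iff₀ hω] at hm₀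
  -- the midpoint of `1 / 2` and `1 - Re ρ`
  set σ : ℝ := 3 / 4 - ρ.re / 2 with hσ
  set z : ℕ → ℂ := fun i => 1 - (starRingEnd ℂ) (ρ + ((m₀ + i : ℕ) : ℤ) * (ω * Complex.I)) with hz
  have him : ∀ i, (z i).im = ρ.im + (m₀ + i) * ω := fun i => by simp [hz]; ring
  have hre : ∀ i, (z i).re = 1 - ρ.re := fun i => by simp [hz]
  have hiω : ∀ i : ℕ, (0 : ℝ) ≤ i * ω := fun i => by positivity
  have hz0 : ∀ i, F (z i) = 0 := fun i => hH _ (by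
    have h1 := him i
    rw [hz, one_sub_conj_im] at h1
    rw [h1]
    nlinarith [hiω i]) (hall _)
  have hcount : ∀ N : ℕ, (N : ℝ) ≤ zeroCount F σ (|ρ.im| + m₀ * ω + N * ω) := by
    intro N
    have hinj : Function.Injective z := by
      intro i j hij
      have := congrArg Complex.im hij
      rw [him, him] at this
      have h2 := mul_right_cancel₀ hω.ne' (add_left_cancel this)
      exact_mod_cast add_left_cancel h2
    have hsub : (((Finset.range N).image z : Finset ℂ) : Set ℂ) ⊆
        {ρ' : ℂ | F ρ' = 0 ∧ σ < ρ'.re ∧ |ρ'.im| ≤ |ρ.im| + m₀ * ω + N * ω} := by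
      intro w hw
      rw [Finset.mem_coe, Finset.mem_image] at hw
      obtain ⟨i, hi, rfl⟩ := hw
      have hiN : (i : ℝ) ≤ N := by exact_mod_cast (Finset.mem_range.1 hi).le
      refine ⟨hz0 i, by rw [hre, hσ]; linarith, ?_⟩
      rw [him]
      refine (abs_add_le _ _).trans ?_
      rw [abs_of_nonneg (by positivity : 0 ≤ ((m₀ : ℝ) + i) * ω)]
      nlinarith
    have := Set.ncard_le_ncard hsub (hF.finite_zeros _ _)
    rw [Set.ncard_coe_finset, Finset.card_image_of_injective _ hinj, Finset.card_range] at this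
    exact_mod_cast this
  have hlo := (hN σ (by rw [hσ]; linarith)).bound (show (0 : ℝ) < 1 / (2 * ω) by positivity)
  have htend : Tendsto (fun N : ℕ => |ρ.im| + m₀ * ω + N * ω) atTop atTop :=
    tendsto_atTop_add_const_left _ _ (tendsto_natCast_atTop_atTop.atTop_mul_const hω)
  obtain ⟨N, hN1, hN2⟩ := ((htend.eventually hlo).and
    (tendsto_natCast_atTop_atTop.eventually_gt_atTop ((|ρ.im| + m₀ * ω) / ω))).exists
  rw [div_lt_iff₀ hω] at hN2
  have hT : 0 ≤ |ρ.im| + m₀ * ω + N * ω := by positivity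
  rw [Real.norm_of_nonneg (Nat.cast_nonneg _), Real.norm_of_nonneg hT] at hN1
  have := (hcount N).trans hN1
  rw [one_div_mul_eq_div, le_div_iff₀ (by positivity)] at this
  linarith

/-- Identity theorem for a meromorphic function `f` and a product `F g` on a half plane. -/
lemma eqOn_strip_of_meromorphic {f F g : ℂ → ℂ} {θ : ℝ}
    (hf : ∀ s, MeromorphicAt f s) (hFm : ∀ s, MeromorphicAt F s)
    (hf1 : DifferentiableOn ℂ f {s : ℂ | s.re < 1})
    (hF1 : DifferentiableOn ℂ F {s : ℂ | s.re < 1})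
    (hg : DifferentiableOn ℂ g {s : ℂ | θ < s.re})
    (h : ∀ s : ℂ, 1 < s.re → f s = F s * g s) {s : ℂ} (hs : θ < s.re) (hs1 : s.re < 1) :
    f s = F s * g s := by
  have hO : IsOpen {s : ℂ | θ < s.re} := isOpen_lt continuous_const Complex.continuous_re
  have hO1 : IsOpen {s : ℂ | s.re < 1} := isOpen_lt Complex.continuous_re continuous_const
  have hmer : MeromorphicOn (fun s => f s - F s * g s) {s : ℂ | θ < s.re} := fun w hw =>
    (hf w).sub ((hFm w).mul (hg.analyticAt (hO.mem_nhds hw)).meromorphicAt)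
  have htop : meromorphicOrderAt (fun s => f s - F s * g s) s = ⊤ := by
    by_contra hne
    have h2 : (2 : ℂ) ∈ {s : ℂ | θ < s.re} := by simp; linarith
    refine hmer.meromorphicOrderAt_ne_top_of_isPreconnected
      (convex_halfSpace_re_gt θ).isPreconnected hs h2 hne ?_
    rw [meromorphicOrderAt_eq_top_iff]
    have : {s : ℂ | 1 < s.re} ∈ nhds (2 : ℂ) :=
      (isOpen_lt continuous_const Complex.continuous_re).mem_nhds (by norm_num)
    filter_upwards [mem_nhdsWithin_of_mem_nhds this] with w hw
    rw [h w hw, sub_self]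
  rw [meromorphicOrderAt_eq_top_iff] at htop
  have hcont : ContinuousAt (fun s => f s - F s * g s) s :=
    (hf1.differentiableAt (hO1.mem_nhds hs1)).continuousAt.sub
      ((hF1.differentiableAt (hO1.mem_nhds hs1)).continuousAt.mul
        (hg.differentiableAt (hO.mem_nhds hs)).continuousAt)
  have hlim := hcont.tendsto.mono_left (nhdsWithin_le_nhds (s := {s}ᶜ))
  have h0 : Tendsto (fun s => f s - F s * g s) (nhdsWithin s {s}ᶜ) (nhds 0) :=
    tendsto_const_nhds.congr' (htop.mono fun w hw => hw.symm)
  exact sub_eq_zero.1 (tendsto_nhds_unique hlim h0)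

/-- Let `f = F (c₁ - c₂ R)` on a strip `θ < σ < 1`, with `f`, `F` holomorphic for `σ < 1` and `R`
holomorphic for `σ > θ` with period `iω`. If `F` has no full vertical progression of zeros of step
`ω`, then `R` is the restriction of an entire function: at a zero of `F` the quotient `f / F` can be
computed at a translate by a multiple of the period. -/
lemma exists_entire_extension {f F R : ℂ → ℂ} {θ ω : ℝ} {c₁ c₂ : ℂ} (hc : c₂ ≠ 0)
    (hθ : θ < 1 / 2)
    (hf : DifferentiableOn ℂ f {s : ℂ | s.re < 1})
    (hF : DifferentiableOn ℂ F {s : ℂ | s.re < 1})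
    (hR : DifferentiableOn ℂ R {s : ℂ | θ < s.re})
    (hper : ∀ s : ℂ, θ < s.re → ∀ m : ℤ, R (s + m * (ω * Complex.I)) = R s)
    (heq : ∀ s : ℂ, θ < s.re → s.re < 1 → f s = F s * (c₁ - c₂ * R s))
    (hne : ∀ ρ : ℂ, ρ.re < 1 / 2 → ∃ m : ℤ, F (ρ + m * (ω * Complex.I)) ≠ 0) :
    ∃ E : ℂ → ℂ, Differentiable ℂ E ∧ (∀ s : ℂ, θ < s.re → E s = R s) ∧
      (∀ s, E (s + ω * Complex.I) = E s) ∧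
      ∀ s : ℂ, s.re < 1 → f s = F s * (c₁ - c₂ * E s) := by
  have hO : IsOpen {s : ℂ | θ < s.re} := isOpen_lt continuous_const Complex.continuous_re
  have hO1 : IsOpen {s : ℂ | s.re < 1} := isOpen_lt Complex.continuous_re continuous_const
  have hshre : ∀ (s : ℂ) (m : ℤ), (s + m * (ω * Complex.I)).re = s.re := fun s m => by simp
  have hdsh : ∀ (g : ℂ → ℂ), DifferentiableOn ℂ g {s : ℂ | s.re < 1} → ∀ m : ℤ,
      DifferentiableOn ℂ (fun s => g (s + m * (ω * Complex.I))) {s : ℂ | s.re < 1} :=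
    fun g hg m => hg.comp (by fun_prop) fun s hs => by
      simpa only [Set.mem_ofPred_eq, hshre] using hs
  -- on the strip both sides are `F F (c₁ - c₂ R)`, by periodicity
  have hcross : ∀ (m n : ℤ) (s : ℂ), s.re < 1 →
      f (s + m * (ω * Complex.I)) * F (s + n * (ω * Complex.I)) =
        F (s + m * (ω * Complex.I)) * f (s + n * (ω * Complex.I)) := by
    intro m n
    have h1 := ((hdsh f hf m).mul (hdsh F hF n)).analyticOnNhd hO1
    have h2 := ((hdsh F hF m).mul (hdsh f hf n)).analyticOnNhd hO1
    have hs₀ : θ < (((max θ 0 + 1) / 2 : ℝ) : ℂ).re ∧ (((max θ 0 + 1) / 2 : ℝ) : ℂ).re < 1 := by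
      rw [Complex.ofReal_re]
      constructor
      · rcases max_cases θ 0 with h | h <;> linarith [h.1, h.2]
      · rcases max_cases θ 0 with h | h <;> linarith [h.1, h.2]
    refine fun s hs => h1.eqOn_of_preconnected_of_eventuallyEq h2
      (convex_halfSpace_re_lt 1).isPreconnected hs₀.2 ?_ hs
    filter_upwards [hO.mem_nhds hs₀.1, hO1.mem_nhds hs₀.2] with w hw hw1
    have hw : θ < w.re := hw
    have hw1 : w.re < 1 := hw1
    simp only [Pi.mul_apply]
    rw [heq _ (by rwa [hshre]) (by rwa [hshre]), heq (w + n * (ω * Complex.I))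
      (by rwa [hshre]) (by rwa [hshre]), hper w hw, hper w hw]
    ring
  have hne' : ∀ s : ℂ, ∃ m : ℤ, s.re ≤ θ → F (s + m * (ω * Complex.I)) ≠ 0 := by
    intro s
    by_cases hs : s.re ≤ θ
    · obtain ⟨m, hm⟩ := hne s (by linarith)
      exact ⟨m, fun _ => hm⟩
    · exact ⟨0, fun h => absurd h hs⟩
  choose μ hμ using hne'
  set E : ℂ → ℂ := fun s => if θ < s.re then R s else
    (c₁ - f (s + μ s * (ω * Complex.I)) / F (s + μ s * (ω * Complex.I))) / c₂ with hE
  have hER : ∀ s : ℂ, θ < s.re → E s = R s := fun s hs => if_pos hs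
  have hEm : ∀ (s : ℂ) (m : ℤ), s.re < 1 → F (s + m * (ω * Complex.I)) ≠ 0 →
      E s = (c₁ - f (s + m * (ω * Complex.I)) / F (s + m * (ω * Complex.I))) / c₂ := by
    intro s m hs hm
    by_cases hsθ : θ < s.re
    · rw [hER s hsθ, heq (s + m * (ω * Complex.I)) (by rwa [hshre]) (by rwa [hshre]),
        hper s hsθ, mul_div_cancel_left₀ _ hm, sub_sub_cancel, mul_div_cancel_left₀ _ hc]
    · have hm' := hμ s (not_lt.1 hsθ)
      rw [hE]
      simp only [if_neg hsθ]
      rw [(div_eq_div_iff hm' hm).2 (by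
        rw [hcross (μ s) m s hs, mul_comm])]
  have hEd : Differentiable ℂ E := by
    intro s
    by_cases hsθ : θ < s.re
    · refine (hR.differentiableAt (hO.mem_nhds hsθ)).congr_of_eventuallyEq ?_
      filter_upwards [hO.mem_nhds hsθ] with w hw using hER w hw
    · have hs1 : s.re < 1 := by linarith
      have hm := hμ s (not_lt.1 hsθ)
      have hdf := (hdsh f hf (μ s)).differentiableAt (hO1.mem_nhds hs1)
      have hdF := (hdsh F hF (μ s)).differentiableAt (hO1.mem_nhds hs1)
      refine DifferentiableAt.congr_of_eventuallyEq
        (((differentiableAt_const c₁).sub (hdf.div hdF hm)).div_const c₂) ?_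
      filter_upwards [hO1.mem_nhds hs1, hdF.continuousAt.eventually_ne hm] with w hw1 hw
        using hEm w (μ s) hw1 hw
  refine ⟨E, hEd, hER, fun s => ?_, fun s hs => ?_⟩
  · have h1 : Differentiable ℂ fun s => E (s + ω * Complex.I) := by fun_prop
    have := ((h1.differentiableOn (s := Set.univ)).analyticOnNhd
      isOpen_univ).eqOn_of_preconnected_of_eventuallyEq
      ((hEd.differentiableOn (s := Set.univ)).analyticOnNhd isOpen_univ) isPreconnected_univ
      (Set.mem_univ ((θ + 1 : ℝ) : ℂ)) ?_ (Set.mem_univ s)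
    · exact this
    · have hmem : ((θ + 1 : ℝ) : ℂ) ∈ {s : ℂ | θ < s.re} := by simp
      filter_upwards [hO.mem_nhds hmem] with w hw
      have hsh := hshre w 1
      have hp := hper w hw 1
      rw [Int.cast_one, one_mul] at hsh hp
      rw [hER w hw, hER _ (by rw [hsh]; exact hw), hp]
  · by_cases hsθ : θ < s.re
    · rw [hER s hsθ]; exact heq s hsθ hs
    · have hm := hμ s (not_lt.1 hsθ)
      have h0 := hcross 0 (μ s) s hs
      rw [hEm s (μ s) hs hm, mul_div_cancel₀ _ hc, sub_sub_cancel, mul_div_assoc', eq_div_iff hm]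
      simpa using h0

end SelbergTwist

/-! ### The local factor of a twist in `M(d, h)` -/

namespace SelbergTwist

variable {a : ℕ → ℂ} {F : ℂ → ℂ} {D : FunctionalEquationData} {p : ℕ}

/-- A Dirichlet series in `p^{-s}` has the period `2πi / log p`. -/
lemma LSeries_primePart_add_period (hp : p.Prime) (f : ℕ → ℂ) (s : ℂ) (m : ℤ) :
    LSeries (primePart p f) (s + m * ((2 * Real.pi / Real.log p : ℝ) * Complex.I)) =
      LSeries (primePart p f) s := by
  have hp0 : (p : ℂ) ≠ 0 := by exact_mod_cast hp.ne_zero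
  have hlog : (Real.log p : ℂ) ≠ 0 := by
    exact_mod_cast (Real.log_pos (by exact_mod_cast hp.one_lt)).ne'
  rw [LSeries_primePart hp, LSeries_primePart hp]
  refine tsum_congr fun k => ?_
  congr 1
  rw [Complex.cpow_def_of_ne_zero hp0, Complex.cpow_def_of_ne_zero hp0, ← Complex.natCast_log]
  have : (Real.log p : ℂ) * -(k * (s + m * ((2 * Real.pi / Real.log p : ℝ) * Complex.I))) =
      Real.log p * -(k * s) + ((-(k * m) : ℤ) : ℂ) * (2 * Real.pi * Complex.I) := by
    generalize Real.log p = l at hlog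
    push_cast
    field_simp
    ring
  rw [this, Complex.exp_add, Complex.exp_int_mul_two_pi_mul_I, mul_one]

lemma tendsto_exp_linear_add_log {δ : ℝ} (hδ : δ < 0) (K C : ℝ) :
    Tendsto (fun x : ℝ => K * Real.exp (δ * x + C * Real.log x)) atTop (nhds 0) := by
  have h := (tendsto_rpow_mul_exp_neg_mul_atTop_nhds_zero C (-δ) (by linarith)).const_mul K
  rw [mul_zero] at h
  refine h.congr' ?_
  filter_upwards [eventually_gt_atTop 0] with x hx
  rw [Real.rpow_def_of_pos hx, ← Real.exp_add]
  ring_nf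

/-- An entire function with period `2πi / log p` that is bounded far to the right is an entire
function of `p^{-s}`. -/
lemma exists_entire_of_periodic (hp : p.Prime) {E : ℂ → ℂ} (hE : Differentiable ℂ E)
    (hper : ∀ s, E (s + (2 * Real.pi / Real.log p : ℝ) * Complex.I) = E s) {K : ℝ}
    (hbd : ∀ s : ℂ, 1 ≤ s.re → ‖E s‖ ≤ K)
    (hlim : Tendsto (fun x : ℝ => E x) atTop (nhds 1)) :
    ∃ P : ℂ → ℂ, Differentiable ℂ P ∧ P 0 = 1 ∧ ∀ s : ℂ, P ((p : ℂ) ^ (-s)) = E s := by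
  have hp0 : (p : ℂ) ≠ 0 := by exact_mod_cast hp.ne_zero
  have hL : 0 < Real.log p := Real.log_pos (by exact_mod_cast hp.one_lt)
  have hpi := Real.pi_pos
  set ω : ℝ := 2 * Real.pi / Real.log p with hω
  have hω0 : 0 < ω := by positivity
  have hωc : (ω : ℂ) ≠ 0 := by exact_mod_cast hω0.ne'
  set φ : ℂ → ℂ := fun z => E (-(ω * Complex.I) * z) with hφ
  have hφper : Function.Periodic φ ((1 : ℝ) : ℂ) := by
    intro z
    simp only [hφ]
    rw [← hper]
    congr 1
    push_cast; ring
  have hφd : Differentiable ℂ φ := by fun_prop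
  have hre : ∀ z : ℂ, (-(ω * Complex.I) * z).re = ω * z.im := fun z => by simp
  have hφbd : BoundedAtFilter (comap Complex.im atTop) φ := by
    refine IsBigO.of_bound K ?_
    filter_upwards [tendsto_comap.eventually (eventually_ge_atTop (1 / ω))] with z hz
    rw [div_le_iff₀ hω0] at hz
    exact (hbd (-(ω * Complex.I) * z) (by rw [hre]; linarith)).trans (by simp)
  have hev : ∀ᶠ z in comap Complex.im atTop, DifferentiableAt ℂ φ z :=
    Eventually.of_forall fun z => hφd z
  refine ⟨Function.Periodic.cuspFunction 1 φ, fun q => ?_, ?_, fun s => ?_⟩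
  · by_cases hq : q = 0
    · rw [hq]
      exact Function.Periodic.differentiableAt_cuspFunction_zero one_pos hφper hev hφbd
    · rw [← Function.Periodic.qParam_right_inv (h := 1) one_ne_zero hq]
      exact Function.Periodic.differentiableAt_cuspFunction one_ne_zero hφper (hφd _)
  · have h1 := Function.Periodic.tendsto_at_I_inf one_pos hφper hev hφbd
    have h2 : Tendsto (fun x : ℝ => ((x / ω : ℝ) : ℂ) * Complex.I) atTop
        (comap Complex.im atTop) := by
      rw [tendsto_comap_iff]
      refine (tendsto_id.atTop_div_const hω0).congr fun x => ?_
      simp only [Function.comp, Complex.im_ofReal_mul, Complex.I_im, mul_one, id]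
    refine tendsto_nhds_unique (h1.comp h2) (hlim.congr fun x => ?_)
    simp only [hφ, Function.comp]
    congr 1
    push_cast
    field_simp
    rw [Complex.I_sq]; ring
  · have h1 := Function.Periodic.eq_cuspFunction one_ne_zero hφper (Complex.I / ω * s)
    have h2 : φ (Complex.I / ω * s) = E s := by
      simp only [hφ]
      congr 1
      field_simp
      rw [Complex.I_sq]; ring
    have h3 : Function.Periodic.qParam 1 (Complex.I / ω * s) = (p : ℂ) ^ (-s) := by
      rw [Function.Periodic.qParam, Complex.cpow_def_of_ne_zero hp0, ← Complex.natCast_log]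
      congr 1
      have hLc : (Real.log p : ℂ) ≠ 0 := by exact_mod_cast hL.ne'
      have hpic : (Real.pi : ℂ) ≠ 0 := by exact_mod_cast hpi.ne'
      rw [hω]
      push_cast
      field_simp
      rw [Complex.I_sq]
      ring
    rw [← h3, h1, h2]

/-- The converse direction for the local factor: if the residual twist belongs to `M(d, h)`, then
`1 / F_p` is a polynomial in `p^{-s}`, with inverse roots in the closed unit disc and with its
degree controlled by `h`. -/
lemma IsSelberg.exists_localFactor_eq_prod (hF : IsSelberg a F D)
    (hN : ∀ σ : ℝ, 1 / 2 < σ →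
      (fun T : ℝ => (zeroCount F σ T : ℝ)) =o[atTop] (fun T : ℝ => T))
    (hp : p.Prime) {h : ℝ} (hh : 0 < h) (hmem : SeriesMemM D.degree h (residualTwist a p)) :
    ∃ (k : ℕ) (α : Fin k → ℂ),
      (∀ s : ℂ, 0 < s.re → localFactor a p s = ∏ j, (1 - α j * (p : ℂ) ^ (-s))⁻¹) ∧
      (∀ j, ‖α j‖ ≤ 1) ∧
      (k : ℤ) ≤ ⌊Real.log (h / D.conductor) / Real.log (p : ℝ)⌋ := by
  have : Fact p.Prime := ⟨hp⟩
  have hp0 : (p : ℂ) ≠ 0 := by exact_mod_cast hp.ne_zero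
  have hp0' : (0 : ℝ) < p := by exact_mod_cast hp.pos
  have hp1 : (1 : ℝ) < p := by exact_mod_cast hp.one_lt
  set L := Real.log p
  have hL : 0 < L := Real.log_pos hp1
  have hpi := Real.pi_pos
  set ω : ℝ := 2 * Real.pi / L with hω
  have hω0 : 0 < ω := by positivity
  obtain ⟨b, θ, hθ0, hθ, hbs, hbE⟩ := hF.exists_log_localFactor hp
  obtain ⟨f, hf, hfe⟩ := hmem
  set R : ℂ → ℂ := fun s => Complex.exp (-LSeries (primePart p b) s) with hR
  have hlR : ∀ s : ℂ, θ < s.re → localFactor a p s * R s = 1 := fun s hs => by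
    rw [hbE s hs, hR, ← Complex.exp_add, add_neg_cancel, Complex.exp_zero]
  have hRd : DifferentiableOn ℂ R {s : ℂ | θ < s.re} := fun s hs =>
    (LSeries_hasDerivAt (abscissa_lt_of_summable hbs hs)).neg.cexp.differentiableAt
      |>.differentiableWithinAt
  have hFd : DifferentiableOn ℂ F {s : ℂ | s.re < 1} := fun s hs =>
    (hF.differentiableAt (by rintro rfl; norm_num at hs)).differentiableWithinAt
  -- `R = 1 / F_p` extends to an entire function
  obtain ⟨E, hEd, hER, hEper, hfE⟩ := exists_entire_extension (f := f) (F := F) (R := R) (ω := ω)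
    (c₁ := (p : ℂ) - 1) hp0 hθ hf.holomorphic hFd hRd
    (fun s _ m => by simp only [hR]; rw [LSeries_primePart_add_period hp b s m])
    (fun s hs hs1 => eqOn_strip_of_meromorphic hf.meromorphic hF.meromorphicAt hf.holomorphic hFd
      ((differentiableOn_const _).sub (hRd.const_mul _))
      (fun w hw => by rw [hfe w hw, hF.LSeries_residualTwist hw (hlR w (by linarith))]; rfl) hs hs1)
    (fun ρ hρ => hF.exists_ne_zero_of_density hN hω0 hρ)
  have hlE : ∀ s : ℂ, 0 < s.re → localFactor a p s * E s = 1 := by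
    have hO : IsOpen {s : ℂ | 0 < s.re} := isOpen_lt continuous_const Complex.continuous_re
    have hO1 : IsOpen {s : ℂ | θ < s.re} := isOpen_lt continuous_const Complex.continuous_re
    have hmem1 : (1 : ℂ) ∈ {s : ℂ | θ < s.re} := by simp; linarith
    refine fun s hs => (((hF.differentiableOn_localFactor hp).mul
      hEd.differentiableOn).analyticOnNhd hO).eqOn_of_preconnected_of_eventuallyEq
      (analyticOnNhd_const (v := (1 : ℂ))) (convex_halfSpace_re_gt 0).isPreconnected
      (z₀ := 1) (by simp) ?_ hs
    filter_upwards [hO1.mem_nhds hmem1] with w hw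
    rw [Pi.mul_apply, hER w hw, hlR w hw]
  -- and that function is entire in `p^{-s}`
  have hElim : Tendsto (fun x : ℝ => E x) atTop (nhds 1) := by
    have h1 := (LSeries.tendsto_atTop (abscissa_lt_top_of_summable
      fun s hs => hF.summable_primePart hp hs)).inv₀
      (by rw [primePart_one, hF.coeff_one]; exact one_ne_zero)
    rw [primePart_one, hF.coeff_one, inv_one] at h1
    refine h1.congr' ?_
    filter_upwards [eventually_gt_atTop 0] with x hx
    rw [← localFactor_eq_LSeries hp]
    exact inv_eq_of_mul_eq_one_right (hlE x (by simpa using hx))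
  obtain ⟨P, hPd, hP0, hPE⟩ := exists_entire_of_periodic hp hEd hEper
    (K := Real.exp (∑' n, ‖LSeries.term (primePart p b) 1 n‖)) (fun s hs => by
      rw [hER s (by linarith), hR, Complex.norm_exp]
      refine Real.exp_le_exp.2 ((Complex.re_le_norm _).trans ?_)
      rw [norm_neg]
      have h1 := hbs 1 (by simp; linarith)
      have hle : ∀ n, ‖LSeries.term (primePart p b) s n‖ ≤ ‖LSeries.term (primePart p b) 1 n‖ :=
        LSeries.norm_term_le_of_re_le_re _ (by simpa using hs)
      have hsm := h1.norm.of_nonneg_of_le (fun _ => norm_nonneg _) hle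
      exact (norm_tsum_le_tsum_norm hsm).trans (hsm.tsum_le_tsum hle h1.norm)) hElim
  -- comparison of the growth of `f` and `F` in a strip of one period without trivial zeros
  obtain ⟨A, hA⟩ := hF.le_norm
  obtain ⟨C₂, hC₂⟩ := hA A (A + ω) le_rfl
  obtain ⟨C₁, K, hC₁⟩ := hf.growth_exp hh (A := A) (B := A + ω) (by linarith)
  set ℓ := Real.log (h / D.conductor) with hℓ
  have hquot : ∀ᶠ x : ℝ in atTop, ∀ t ∈ Set.Icc A (A + ω),
      ‖(p : ℂ) - 1 - p * E (-x + t * Complex.I)‖ ≤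
        |K| * Real.exp (ℓ * x + (C₁ + C₂) * Real.log x) := by
    filter_upwards [hC₁, hC₂, eventually_ge_atTop 0] with x h1 h2 hx t ht
    have h1 := h1 t ht
    have h2 := h2 t ht
    have hre : (-x + t * Complex.I : ℂ).re < 1 := by simp; linarith
    rw [hfE _ hre, norm_mul] at h1
    refine le_of_mul_le_mul_left ?_ (Real.exp_pos
      (mainTerm D.degree D.conductor x - C₂ * Real.log x))
    calc _ ≤ ‖F (-x + t * Complex.I)‖ * ‖(p : ℂ) - 1 - p * E (-x + t * Complex.I)‖ := by gcongr
      _ ≤ K * Real.exp (mainTerm D.degree h x + C₁ * Real.log x) := h1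
      _ ≤ |K| * Real.exp (mainTerm D.degree h x + C₁ * Real.log x) := by
          gcongr; exact le_abs_self K
      _ = _ := by
          rw [mul_left_comm, ← Real.exp_add]
          congr 2
          linarith [mainTerm_sub (d := D.degree) (x := x) hh D.conductor_pos]
  have hgrowth : ∀ η : ℝ, max (ℓ / L) 0 < η →
      ∀ᶠ r : ℝ in atTop, ∀ z : ℂ, ‖z‖ = r → ‖P z‖ ≤ r ^ η := by
    intro η hη
    have hη1 : ℓ - η * L < 0 := by
      have := (le_max_left _ _).trans_lt hη
      rw [div_lt_iff₀ hL] at this; linarith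
    have hη2 : -(η * L) < 0 := by
      have := mul_pos ((le_max_right _ _).trans_lt hη) hL; linarith
    have hsmall := (tendsto_exp_linear_add_log hη2 1 0).add
      (tendsto_exp_linear_add_log hη1 |K| (C₁ + C₂))
    rw [add_zero] at hsmall
    have hx : ∀ᶠ x : ℝ in atTop, ∀ t ∈ Set.Icc A (A + ω),
        ‖E (-x + t * Complex.I)‖ ≤ Real.exp (η * L * x) := by
      filter_upwards [hquot, hsmall.eventually_le_const one_pos] with x h1 h2 t ht
      have h3 : ‖(p : ℂ) * E (-x + t * Complex.I)‖ ≤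
          ‖(p : ℂ) - 1‖ + ‖(p : ℂ) - 1 - p * E (-x + t * Complex.I)‖ := by
        have := norm_sub_le ((p : ℂ) - 1) ((p : ℂ) - 1 - p * E (-x + t * Complex.I))
        rwa [sub_sub_cancel] at this
      have h4 : ‖(p : ℂ) - 1‖ ≤ p := by
        have : (p : ℂ) - 1 = ((p - 1 : ℝ) : ℂ) := by push_cast; ring
        rw [this, Complex.norm_real, Real.norm_of_nonneg (by linarith)]
        linarith
      rw [norm_mul, Complex.norm_natCast] at h3
      have h5 : ‖E (-x + t * Complex.I)‖ ≤
          1 + |K| * Real.exp (ℓ * x + (C₁ + C₂) * Real.log x) := by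
        have h6 := h1 t ht
        have h7 : 0 ≤ |K| * Real.exp (ℓ * x + (C₁ + C₂) * Real.log x) := by positivity
        refine le_of_mul_le_mul_left ?_ hp0'
        nlinarith
      refine h5.trans ?_
      have h8 := mul_le_mul_of_nonneg_left h2 (Real.exp_pos (η * L * x)).le
      rw [mul_one, mul_add, one_mul, mul_left_comm, ← Real.exp_add, ← Real.exp_add] at h8
      refine le_trans (le_of_eq ?_) h8
      congr 1
      · rw [← Real.exp_zero]; congr 1; ring
      · congr 2; ring
    have hlogL : Tendsto (fun r : ℝ => Real.log r / L) atTop atTop :=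
      Real.tendsto_log_atTop.atTop_div_const hL
    filter_upwards [hlogL.eventually hx, eventually_gt_atTop 0] with r hr hr0 z hz
    have hz0 : z ≠ 0 := by rw [← norm_pos_iff, hz]; exact hr0
    set w : ℂ := -(Complex.log z / L) with hw
    have hLc : (L : ℂ) ≠ 0 := by exact_mod_cast hL.ne'
    have hpw : (p : ℂ) ^ (-w) = z := by
      rw [Complex.cpow_def_of_ne_zero hp0, ← Complex.natCast_log, hw, neg_neg,
        mul_div_cancel₀ _ hLc, Complex.exp_log hz0]
    -- translate the logarithm of `z` into the strip on which the bound is known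
    obtain ⟨n, hn, -⟩ := existsUnique_add_zsmul_mem_Ico hω0 w.im A
    have hEw : E (-(Real.log r / L : ℝ) + ((w.im + n • ω : ℝ) : ℂ) * Complex.I) = E w := by
      have hperZ := (show Function.Periodic E (ω * Complex.I) from hEper).int_mul n w
      rw [← hperZ]
      congr 1
      have hwre : w.re = -(Real.log r / L) := by
        rw [hw, Complex.neg_re, Complex.div_ofReal_re, Complex.log_re, hz]
      have hwdec := Complex.re_add_im w
      rw [hwre] at hwdec
      conv_rhs => rw [← hwdec]
      simp only [zsmul_eq_mul]
      push_cast
      ring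
    have h1 := hr _ (Set.Ico_subset_Icc_self hn)
    rw [hEw, ← hPE w, hpw] at h1
    rw [Real.rpow_def_of_pos hr0]
    refine h1.trans (le_of_eq ?_)
    congr 1
    field_simp
  obtain ⟨k, α, hk, hα, hPα⟩ := exists_factorization hPd hP0 hgrowth
  refine ⟨k, α, fun s hs => ?_, fun j => ?_, ?_⟩
  · rw [Finset.prod_inv_distrib, ← hPα, hPE]
    exact eq_inv_of_mul_eq_one_left (hlE s hs)
  · -- a zero of `P` in the open unit disc would be a zero of `1 / F_p` in `σ > 0`
    by_contra! hcon
    have hα0 := (hα j).1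
    have hLc : (L : ℂ) ≠ 0 := by exact_mod_cast hL.ne'
    set s : ℂ := Complex.log (α j) / L with hs
    have hsre : 0 < s.re := by
      rw [hs, Complex.div_ofReal_re, Complex.log_re]
      exact div_pos (Real.log_pos hcon) hL
    have hps : (p : ℂ) ^ (-s) = (α j)⁻¹ := by
      rw [Complex.cpow_neg, Complex.cpow_def_of_ne_zero hp0, ← Complex.natCast_log, hs,
        mul_div_cancel₀ _ hLc, Complex.exp_log hα0]
    have h1 := hlE s hsre
    rw [← hPE, hps, (hα j).2, mul_zero] at h1
    exact zero_ne_one h1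
  · have hκ : 0 ≤ ℓ / L := by
      -- otherwise `P = 1`, hence `f = -F`, and `f` would grow more slowly than `F`
      by_contra! hneg
      rw [max_eq_right hneg.le] at hk
      have hk0 : k = 0 := by exact_mod_cast le_antisymm hk (Nat.cast_nonneg k)
      subst hk0
      have hE1 : ∀ s, E s = 1 := fun s => by rw [← hPE, hPα]; simp
      have hℓ0 : ℓ < 0 := by
        by_contra! h0
        exact absurd (div_nonneg h0 hL.le) (not_le.2 hneg)
      have hsm := (tendsto_exp_linear_add_log hℓ0 |K| (C₁ + C₂)).eventually_lt_const
        (show (0 : ℝ) < 1 from one_pos)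
      obtain ⟨x, hx1, hx2⟩ := (hquot.and hsm).exists
      have := hx1 A ⟨le_rfl, by linarith⟩
      rw [hE1, mul_one, show (p : ℂ) - 1 - p = -1 by ring, norm_neg, norm_one] at this
      linarith
    rw [max_eq_left hκ] at hk
    exact Int.le_floor.2 (by exact_mod_cast hk)

end SelbergTwist

theorem theorem1 (d : ℝ) (hd : 0 < d) (a : ℕ → ℂ) (F : ℂ → ℂ) (D : FunctionalEquationData)
    (hF : IsSelberg a F D) (hdeg : D.degree = d)
    (hN : ∀ σ : ℝ, 1 / 2 < σ →
      (fun T : ℝ => (zeroCount F σ T : ℝ)) =o[atTop] (fun T : ℝ => T))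
    (p : ℕ) (hp : p.Prime) (h : ℝ) (hh : 0 < h) :
    (∀ b : ℤ, ¬ (p : ℤ) ∣ b → SeriesMemM d h (linearTwist a ((b : ℝ) / (p : ℝ)))) ↔
      ((∀ χ : DirichletCharacter ℂ p, χ ≠ 1 → SeriesMemM d h (characterTwist a χ)) ∧
        ∃ (k : ℕ) (α : Fin k → ℂ),
          (∀ s : ℂ, 0 < s.re →
            localFactor a p s = ∏ j, (1 - α j * (p : ℂ) ^ (-s))⁻¹) ∧
          (∀ j, ‖α j‖ ≤ 1) ∧
          (k : ℤ) ≤ ⌊Real.log (h / D.conductor) / Real.log (p : ℝ)⌋) := by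
  have : Fact p.Prime := ⟨hp⟩
  subst hdeg
  rw [hF.linearTwist_mem_iff hh]
  refine and_congr_right fun _ => ⟨fun hres => ?_, ?_⟩
  · exact hF.exists_localFactor_eq_prod hN hp hh hres
  · rintro ⟨k, α, hα, hα1, hk⟩
    exact hF.residualTwist_mem hp hh hα hα1 hk
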